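/- **Setting.** Let $d\ge 0$, $s\ge 1$ be integers, $a=t_0<t_1<\dots<t_s=b$, $h_i:=t_i-t_{i-1}$, and let $B^N_j(u)=\binom Nj u^j(1-u)^{N-j}$. Let $n_i,m_i$ $(1\le i\le s)$ and $r_0,\dots,r_s$ be natural numbers (including $0$) with $m_i<n_i$ and $r_{i-1}+r_i<m_i-1$ for $i=1,\dots,s$. Let $p_{i,j}\in\mathbb R^d$ $(1\le i\le s,\ 0\le j\le n_i)$, $P_i(u)=\sum_{j=0}^{n_i}p_{i,j}B^{n_i}_j(u)$, and let $P$ be a composite curve with $P(t)=P_i((t-t_{i-1})/h_i)$ for $t_{i-1}<t<t_i$, and also at $t=a$ (for $i=1$) and at $t=b$ (for $i=s$); the values of $P$ at $t_1,\dots,t_{s-1}$ are arbitrary, so that the segments need not join. **Problem.** Find control points $q_{i,j}\in\mathbb R^d$ $(1\le i\le s,\ 0\le j\le m_i)$ of a composite Bézier curve $Q$, $Q(t)=\sum_{j=0}^{m_i}q_{i,j}B^{m_i}_j((t-t_{i-1})/h_i)$ for $t_{i-1}\le t\le t_i$, which minimizes $\int_a^b\|P(t)-Q(t)\|^2\,dt$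 (Euclidean norm) among all such curves that satisfy $Q^{(j)}(t_0)=P^{(j)}(t_0)$ for $0\le j\le r_0$, $Q^{(j)}(t_s)=P^{(j)}(t_s)$ for $0\le j\le r_s$ (one-sided derivatives), and $Q^{(j)}(t_i-)=Q^{(j)}(t_i+)$ for $1\le i\le s-1$, $0\le j\le r_i$. **The $C$-table.** For $k+l<m-1$ define $C_{j,h}=C_{j,h}(m,k,l)$, $k+1\le j,h\le m-l-1$ (and $C_{j,h}:=0$ for all other $j,h$), by $$C_{k+1,m-l-1}:=\tbinom m{k+1}^{-1}\tbinom m{l+1}^{-1}\frac{(-1)^{m-k-l-2}(m+k+l+3)!}{(m-k-l-2)!\,(2k+2)!\,(2l+2)!},$$ $$C_{k+1,h}:=\frac{(h-m)(h-k)(h+k+3)}{(h+1)[(h-m)^2-(l+1)^2]}\,C_{k+1,h+1}\qquad(h=m-l-2,\dots,k+1),$$ and, for $j=k+1,\dots,m-l-2$ and $k+1\le h\le m-l-1$, $$C_{j+1,h}:=\frac1{A(j)}\bigl\{2(j-h)(j+h-m)C_{j,h}+B(h)C_{j,h-1}+A(h)C_{j,h+1}-B(j)C_{j-1,h}\bigr\},$$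 where $A(u)=(u-m)(u-k)(u+k+2)/(u+1)$ and $B(u)=u(u-m-l-2)(u-m+l)/(u-m-1)$. **Control points as functions of parameters.** Let $(c)_j=c(c+1)\cdots(c+j-1)$ and $\Delta$ be the forward difference in the second index. The parameters are points $\kappa_i\in\mathbb R^d$ and vectors $\lambda_{i,j}\in\mathbb R^d$ $(1\le i\le s-1,\ 1\le j\le r_i)$, i.e. $\sigma=\sum_{i=1}^{s-1}(r_i+1)d$ scalars, collected in $\Lambda\in\mathbb R^\sigma$. Given $\Lambda$, put $$q_{1,j}:=\tbinom{n_1}j\tbinom{m_1}j^{-1}\Delta^jp_{1,0}-\sum_{h=0}^{j-1}(-1)^{j+h}\tbinom jh q_{1,h}\quad(0\le j\le r_0),$$ $$q_{s,m_s-j}:=(-1)^j\tbinom{n_s}j\tbinom{m_s}j^{-1}\Delta^jp_{s,n_s-j}-\sum_{h=1}^{j}(-1)^h\tbinom jh q_{s,m_s-j+h}\quad(0\le j\le r_s),$$ and, for $1\le i\le s-1$, $0\le h\le r_i$, with $a_{i,j}:=h_i^j/(m_i-j+1)_j$, $$q_{i,m_i-h}:=\kappa_i+\sum_{j=1}^h(-1)^j\tbinom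 hj a_{i,j}\lambda_{i,j},\qquad q_{i+1,h}:=\kappa_i+\sum_{j=1}^h\tbinom hj a_{i+1,j}\lambda_{i,j}.$$ The remaining control points of each segment are, with $n=n_i$, $m=m_i$, $k=r_{i-1}$, $l=r_i$ and $k+1\le j\le m-l-1$, $$q_{i,j}:=\sum_{h=k+1}^{m-l-1}C_{j,h}(m,k,l)\,v_h-\Bigl(\sum_{h=0}^k+\sum_{h=m-l}^m\Bigr)K_{j,h}\,q_{i,h},\qquad v_h:=\frac{\binom mh}{n+m+1}\sum_{g=0}^n\tbinom ng\tbinom{n+m}{g+h}^{-1}p_{i,g},$$ $$K_{j,h}:=\tbinom mh\tbinom mj^{-1}\frac{(-1)^{j-k-1}(k+1-h)_{m-k-l-1}(k+2)_h(l+2)_{m-h}}{(j-h)(j-k-1)!\,(m-l-j-1)!\,(k+2)_j(l+2)_{m-j}}.$$ Let $E(\Lambda):=\sum_{i=1}^sE_i$ with $$E_i:=h_i\sum_{c=1}^d\bigl[I_{n_i,n_i}(\mathbf p_i^c,\mathbf p_i^c)+I_{m_i,m_i}(\mathbf q_i^c,\mathbf q_i^c)-2I_{n_i,m_i}(\mathbf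 p_i^c,\mathbf q_i^c)\bigr],$$ where $\mathbf p_i^c,\mathbf q_i^c$ are the vectors of $c$-th coordinates of the control points of the $i$-th segments and $I_{N,M}(x,y):=\frac1{N+M+1}\sum_{i=0}^N\sum_{j=0}^M\binom{N+M}{i+j}^{-1}\binom Ni\binom Mj x_iy_j$. **Claim.** 1. For every $i$, with $m=m_i$, $k=r_{i-1}$, $l=r_i$, the polynomials $D_j=\sum_{h=k+1}^{m-l-1}C_{j,h}(m,k,l)B^m_h$ form the dual constrained Bernstein basis: $\int_0^1D_jB^m_h\,du=\delta_{j,h}$ for $k+1\le j,h\le m-l-1$. 2. For every $\Lambda$ the control points $q_{i,j}$ above are those of a curve $Q$ satisfying all constraints, and $\int_a^b\|P-Q\|^2dt=E(\Lambda)$. 3. The equations $\partial E/\partial\kappa_i^c=\partial(E_i+E_{i+1})/\partial\kappa_i^c=0$ and $\partial E/\partial\lambda_{i,j}^c=\partial(E_i+E_{i+1})/\partial\lambda_{i,j}^c=0$ $(1\le i\le s-1,\ 1\le j\le r_i,\ 1\le c\le d)$ form a system of $\sigma$ linear equations in the $\sigma$ unknowns $\Lambda$, and this system has exactly one solution. 4.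 For the solution $\Lambda$ of this system, the control points $q_{i,j}$ above are the unique solution of the Problem. -/

import Mathlib

open scoped BigOperators Nat Matrix

noncomputable section

namespace Bezier

/-- The Bernstein basis polynomial `B^N_j` evaluated at `u`. -/
def bern (N j : ℕ) (u : ℝ) : ℝ := (N.choose j : ℝ) * u ^ j * (1 - u) ^ (N - j)

/-- The Bézier curve of degree `N` with control points `w 0, …, w N`
(the values `w j` with `j > N` are irrelevant). -/
def curve {d : ℕ} (N : ℕ) (w : ℕ → EuclideanSpace ℝ (Fin d)) (u : ℝ) :
    EuclideanSpace ℝ (Fin d) :=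
  ∑ j ∈ Finset.range (N + 1), bern N j u • w j

/-- The shifted factorial `(c)_j = c (c + 1) ⋯ (c + j - 1)`. -/
def shiftedFactorial (c : ℝ) (j : ℕ) : ℝ := ∏ i ∈ Finset.range j, (c + i)

/-! ### The `C`-table -/

/-- First row of the `C`-table, read from right to left:
`cFirst m k l e` is the entry `C_{k+1, h}` with `h = m - l - 1 - e`. -/
def cFirst (m k l : ℕ) : ℕ → ℝ
  | 0 =>
      ((m.choose (k + 1) : ℝ))⁻¹ * ((m.choose (l + 1) : ℝ))⁻¹ *
        (((-1) ^ (m - k - l - 2) * ((m + k + l + 3)! : ℝ)) /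
          (((m - k - l - 2)! : ℝ) * ((2 * k + 2)! : ℝ) * ((2 * l + 2)! : ℝ)))
  | e + 1 =>
      let h : ℝ := (m : ℝ) - l - 1 - (e + 1)
      ((h - m) * (h - k) * (h + k + 3)) / ((h + 1) * ((h - m) ^ 2 - (l + 1) ^ 2)) *
        cFirst m k l e

/-- The coefficient function `A(u)` of the recurrence for the `C`-table. -/
def cA (m k : ℕ) (u : ℝ) : ℝ := (u - m) * (u - k) * (u + k + 2) / (u + 1)

/-- The coefficient function `B(u)` of the recurrence for the `C`-table. -/
def cB (m l : ℕ) (u : ℝ) : ℝ := u * (u - m - l - 2) * (u - m + l) / (u - m - 1)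

/-- Rows of the `C`-table: `cRow m k l a h` is `C_{k + a, h}`. Row `k` is zero by convention,
row `k + 1` is the first one, and the others follow from the three-row recurrence with
`j = k + a + 1`. Entries with `h` outside `{k+1, …, m-l-1}` are zero. -/
def cRow (m k l : ℕ) : ℕ → ℕ → ℝ
  | 0 => fun _ => 0
  | 1 => fun h => if k + 1 ≤ h ∧ h + l + 1 ≤ m then cFirst m k l (m - l - 1 - h) else 0
  | a + 2 => fun h =>
      if k + 1 ≤ h ∧ h + l + 1 ≤ m then
        let j : ℝ := (k : ℝ) + a + 1
        (1 / cA m k j) *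
          (2 * (j - h) * (j + h - m) * cRow m k l (a + 1) h
            + cB m l h * cRow m k l (a + 1) (h - 1)
            + cA m k h * cRow m k l (a + 1) (h + 1)
            - cB m l j * cRow m k l a h)
      else 0

/-- The entry `C_{j,h}(m,k,l)` of the `C`-table, as produced by the recursive algorithm;
zero unless both indices lie in `{k+1, …, m-l-1}`. -/
def cTable (m k l j h : ℕ) : ℝ :=
  if k + 1 ≤ j ∧ j + l + 1 ≤ m then cRow m k l (j - k) h else 0

/-- `D^{(m,k,l)}_j = ∑_h C_{j,h}(m,k,l) B^m_h`. -/
def dualBern (m k l j : ℕ) (u : ℝ) : ℝ :=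
  ∑ h ∈ Finset.Icc (k + 1) (m - l - 1), cTable m k l j h * bern m h u

/-! ### Degree reduction of one segment with prescribed boundary control points -/

/-- The points `v_h`. -/
def vPoint {d : ℕ} (n m : ℕ) (p : ℕ → EuclideanSpace ℝ (Fin d)) (h : ℕ) :
    EuclideanSpace ℝ (Fin d) :=
  (((n : ℝ) + m + 1)⁻¹ * (m.choose h : ℝ)) •
    ∑ i ∈ Finset.range (n + 1),
      ((n.choose i : ℝ) * (((n + m).choose (i + h) : ℝ))⁻¹) • p i

/-- The coefficients `K_{j,h}`. -/
def kCoeff (m k l j h : ℕ) : ℝ :=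
  (m.choose h : ℝ) * ((m.choose j : ℝ))⁻¹ *
    (((-1) ^ (j - k - 1) * shiftedFactorial ((k : ℝ) + 1 - h) (m - k - l - 1) *
        shiftedFactorial ((k : ℝ) + 2) h * shiftedFactorial ((l : ℝ) + 2) (m - h)) /
      (((j : ℝ) - h) * ((j - k - 1)! : ℝ) * ((m - l - j - 1)! : ℝ) *
        shiftedFactorial ((k : ℝ) + 2) j * shiftedFactorial ((l : ℝ) + 2) (m - j)))

/-- The inner control point `q_j`, computed from the control points `p` of the given curve and the
prescribed boundary control points `q_0, …, q_k, q_{m-l}, …, q_m`. -/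
def innerPoint {d : ℕ} (n m k l : ℕ) (p q : ℕ → EuclideanSpace ℝ (Fin d)) (j : ℕ) :
    EuclideanSpace ℝ (Fin d) :=
  ∑ h ∈ Finset.Icc (k + 1) (m - l - 1), cTable m k l j h • vPoint n m p h
    - (∑ h ∈ Finset.Icc 0 k, kCoeff m k l j h • q h
        + ∑ h ∈ Finset.Icc (m - l) m, kCoeff m k l j h • q h)

/-- The bilinear form `I_{N,M}(x, y)`. -/
def iForm (N M : ℕ) (x y : ℕ → ℝ) : ℝ :=
  ((N : ℝ) + M + 1)⁻¹ *
    ∑ i ∈ Finset.range (N + 1), ∑ j ∈ Finset.range (M + 1),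
      (((N + M).choose (i + j) : ℝ))⁻¹ * (N.choose i : ℝ) * (M.choose j : ℝ) * x i * y j

/-! ### Control points determined by the conditions at the two ends -/

/-- The control points `q_{1,j}` determined by the derivatives at the left end of the curve. -/
def startPoint {d : ℕ} (n m : ℕ) (p : ℕ → EuclideanSpace ℝ (Fin d)) (j : ℕ) :
    EuclideanSpace ℝ (Fin d) :=
  ((n.choose j : ℝ) * ((m.choose j : ℝ))⁻¹) • ((fwdDiff (1 : ℕ))^[j] p 0)
    - ∑ h : Fin j, ((-1 : ℝ) ^ (j + (h : ℕ)) * (j.choose h : ℝ)) • startPoint n m p h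
termination_by j
decreasing_by exact h.2

/-- `endPoint n m p j` is the control point `q_{s,m-j}` determined by the derivatives at the right
end of the curve. (The summation index `h` of the formula is `g + 1` here.) -/
def endPoint {d : ℕ} (n m : ℕ) (p : ℕ → EuclideanSpace ℝ (Fin d)) (j : ℕ) :
    EuclideanSpace ℝ (Fin d) :=
  ((-1 : ℝ) ^ j * (n.choose j : ℝ) * ((m.choose j : ℝ))⁻¹) • ((fwdDiff (1 : ℕ))^[j] p (n - j))
    - ∑ g : Fin j, ((-1 : ℝ) ^ ((g : ℕ) + 1) * (j.choose ((g : ℕ) + 1) : ℝ)) •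
        endPoint n m p (j - ((g : ℕ) + 1))
termination_by j
decreasing_by have := g.2; omega

/-! ### One-sided derivatives and composite Bézier curves -/

/-- The `j`-th right-hand derivative of `F` at `x`. -/
def rightDeriv {d : ℕ} (j : ℕ) (F : ℝ → EuclideanSpace ℝ (Fin d)) (x : ℝ) :
    EuclideanSpace ℝ (Fin d) :=
  iteratedDerivWithin j F (Set.Ici x) x

/-- The `j`-th left-hand derivative of `F` at `x`. -/
def leftDeriv {d : ℕ} (j : ℕ) (F : ℝ → EuclideanSpace ℝ (Fin d)) (x : ℝ) :
    EuclideanSpace ℝ (Fin d) :=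
  iteratedDerivWithin j F (Set.Iic x) x

/-- `F` is the composite Bézier curve with partition points `t 0, …, t (s+1)`, segment degrees
`deg i` and control points `w i j`: on every closed segment it is the Bézier curve
of that segment. -/
def IsComposite {d s : ℕ} (t : Fin (s + 2) → ℝ) (deg : Fin (s + 1) → ℕ)
    (w : Fin (s + 1) → ℕ → EuclideanSpace ℝ (Fin d)) (F : ℝ → EuclideanSpace ℝ (Fin d)) : Prop :=
  ∀ i : Fin (s + 1), ∀ x ∈ Set.Icc (t i.castSucc) (t i.succ),
    F x = curve (deg i) (w i) ((x - t i.castSucc) / (t i.succ - t i.castSucc))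

/-- The same, except that the values at the interior partition points `t 1, …, t s` are left free,
so that consecutive segments need not join. -/
def IsPiecewise {d s : ℕ} (t : Fin (s + 2) → ℝ) (deg : Fin (s + 1) → ℕ)
    (w : Fin (s + 1) → ℕ → EuclideanSpace ℝ (Fin d)) (F : ℝ → EuclideanSpace ℝ (Fin d)) : Prop :=
  (∀ i : Fin (s + 1), ∀ x ∈ Set.Ioo (t i.castSucc) (t i.succ),
    F x = curve (deg i) (w i) ((x - t i.castSucc) / (t i.succ - t i.castSucc))) ∧
  F (t 0) = curve (deg 0) (w 0) 0 ∧
  F (t (Fin.last (s + 1))) = curve (deg (Fin.last s)) (w (Fin.last s)) 1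

/-- The input data for `s + 1` segments in `ℝ^d`: the partition points `t 0, …, t (s+1)`,
the degrees `n i` and `m i` of the `i`-th given and reduced segment (`i = 0, …, s`), the orders
`r 0, …, r (s+1)` of continuity at the partition points, and the control points `p i j`
(`0 ≤ j ≤ n i`) of the given segments. The `i`-th segment lives over
`[t i.castSucc, t i.succ]`. -/
structure Data (d s : ℕ) where
  t : Fin (s + 2) → ℝ
  n : Fin (s + 1) → ℕ
  m : Fin (s + 1) → ℕ
  r : Fin (s + 2) → ℕ
  p : Fin (s + 1) → ℕ → EuclideanSpace ℝ (Fin d)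

namespace Data

variable {d s : ℕ} (D : Data d s)

/-- The length of the `i`-th segment. -/
def len (i : Fin (s + 1)) : ℝ := D.t i.succ - D.t i.castSucc

/-! ### The optimization problem -/

/-- The squared `L₂`-error between two curves over the whole parameter interval. -/
def sqError (P Q : ℝ → EuclideanSpace ℝ (Fin d)) : ℝ :=
  ∫ x in (D.t 0)..(D.t (Fin.last (s + 1))), ‖P x - Q x‖ ^ 2

/-- `Q` is a composite Bézier curve of degree `(m i)_i` with control points `q`, which satisfies
the derivative conditions at both ends and the continuity conditions at
the interior partition points. The interior partition point with index `i : Fin s` lies between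
the segments `i.castSucc` and `i.succ`. -/
def IsAdmissible (P : ℝ → EuclideanSpace ℝ (Fin d))
    (q : Fin (s + 1) → ℕ → EuclideanSpace ℝ (Fin d)) (Q : ℝ → EuclideanSpace ℝ (Fin d)) : Prop :=
  IsComposite D.t D.m q Q ∧
  (∀ j ≤ D.r 0, rightDeriv j Q (D.t 0) = rightDeriv j P (D.t 0)) ∧
  (∀ i : Fin s, ∀ j ≤ D.r i.succ.castSucc,
    leftDeriv j Q (D.t i.succ.castSucc) = rightDeriv j Q (D.t i.succ.castSucc)) ∧
  (∀ j ≤ D.r (Fin.last (s + 1)),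
    leftDeriv j Q (D.t (Fin.last (s + 1))) = leftDeriv j P (D.t (Fin.last (s + 1))))

/-- `q` are the control points of a solution of the constrained degree reduction problem. -/
def IsSolution (P : ℝ → EuclideanSpace ℝ (Fin d))
    (q : Fin (s + 1) → ℕ → EuclideanSpace ℝ (Fin d)) : Prop :=
  ∃ Q, D.IsAdmissible P q Q ∧
    ∀ q' Q', D.IsAdmissible P q' Q' → D.sqError P Q ≤ D.sqError P Q'

/-! ### The algorithm -/

/-- Indices of the scalar parameters: an interior partition point `i`, an order
`j = 0, …, r_i` and a coordinate in `ℝ^d`. The order `j = 0` belongs to the point `κ_i`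
and the orders `j ≥ 1` to the vectors `λ_{i,j}`. -/
abbrev ParamIdx : Type := (Σ i : Fin s, Fin (D.r i.succ.castSucc + 1)) × Fin d

/-- The point `κ_i` of a parameter vector. -/
def kappa (L : D.ParamIdx → ℝ) (i : Fin s) : EuclideanSpace ℝ (Fin d) :=
  WithLp.toLp 2 fun c => L (⟨i, 0⟩, c)

/-- The vector `λ_{i,j}` (`1 ≤ j ≤ r_i`) of a parameter vector. -/
def lam (L : D.ParamIdx → ℝ) (i : Fin s) (j : ℕ) : EuclideanSpace ℝ (Fin d) :=
  if hj : j < D.r i.succ.castSucc + 1 then WithLp.toLp 2 fun c => L (⟨i, ⟨j, hj⟩⟩, c) else 0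

/-- `a_{i,j} = h_i^j / (m_i - j + 1)_j`. -/
def aCoeff (i : Fin (s + 1)) (j : ℕ) : ℝ :=
  D.len i ^ j / shiftedFactorial ((D.m i : ℝ) - j + 1) j

/-- The control point with index `m - h` of the segment that ends at the interior
partition point `i`. -/
def junctionLeft (L : D.ParamIdx → ℝ) (i : Fin s) (h : ℕ) : EuclideanSpace ℝ (Fin d) :=
  D.kappa L i + ∑ j ∈ Finset.Icc 1 h,
    ((-1 : ℝ) ^ j * (h.choose j : ℝ) * D.aCoeff i.castSucc j) • D.lam L i j

/-- The control point with index `h` of the segment that starts at the interior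
partition point `i`. -/
def junctionRight (L : D.ParamIdx → ℝ) (i : Fin s) (h : ℕ) : EuclideanSpace ℝ (Fin d) :=
  D.kappa L i + ∑ j ∈ Finset.Icc 1 h,
    ((h.choose j : ℝ) * D.aCoeff i.succ j) • D.lam L i j

/-- `headPoint L i h` is the prescribed control point with index `h` of the `i`-th segment
(`h ≤ r` for the order `r` at the left end of the segment). -/
def headPoint (L : D.ParamIdx → ℝ) (i : Fin (s + 1)) : ℕ → EuclideanSpace ℝ (Fin d) :=
  Fin.cases (motive := fun _ => ℕ → EuclideanSpace ℝ (Fin d))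
    (startPoint (D.n 0) (D.m 0) (D.p 0)) (fun i' => D.junctionRight L i') i

/-- `tailPoint L i h` is the prescribed control point with index `m - h` of the `i`-th segment
(`h ≤ r` for the order `r` at the right end of the segment). -/
def tailPoint (L : D.ParamIdx → ℝ) (i : Fin (s + 1)) : ℕ → EuclideanSpace ℝ (Fin d) :=
  Fin.lastCases (motive := fun _ => ℕ → EuclideanSpace ℝ (Fin d))
    (endPoint (D.n (Fin.last s)) (D.m (Fin.last s)) (D.p (Fin.last s)))
    (fun i' => D.junctionLeft L i') i

/-- The prescribed boundary control points of the `i`-th segment (zero at the inner indices). -/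
def boundaryPoint (L : D.ParamIdx → ℝ) (i : Fin (s + 1)) (j : ℕ) : EuclideanSpace ℝ (Fin d) :=
  if j ≤ D.r i.castSucc then D.headPoint L i j
  else if D.m i - D.r i.succ ≤ j then D.tailPoint L i (D.m i - j)
  else 0

/-- All control points of the `i`-th segment for the parameter vector `L`: the boundary ones are
prescribed, the inner ones come from the degree reduction of that segment. -/
def controlPoint (L : D.ParamIdx → ℝ) (i : Fin (s + 1)) (j : ℕ) : EuclideanSpace ℝ (Fin d) :=
  if D.r i.castSucc < j ∧ j < D.m i - D.r i.succ then
    innerPoint (D.n i) (D.m i) (D.r i.castSucc) (D.r i.succ) (D.p i) (D.boundaryPoint L i) j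
  else D.boundaryPoint L i j

/-- The error `E_i` of the `i`-th segment as an explicit function of the parameters. -/
def segError (L : D.ParamIdx → ℝ) (i : Fin (s + 1)) : ℝ :=
  D.len i * ∑ c : Fin d,
    (iForm (D.n i) (D.n i) (fun j => D.p i j c) (fun j => D.p i j c)
      + iForm (D.m i) (D.m i) (fun j => D.controlPoint L i j c) (fun j => D.controlPoint L i j c)
      - 2 * iForm (D.n i) (D.m i) (fun j => D.p i j c) (fun j => D.controlPoint L i j c))

/-- The total error `E = ∑ E_i` as an explicit function of the parameters. -/
def totalError (L : D.ParamIdx → ℝ) : ℝ := ∑ i : Fin (s + 1), D.segError L i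

/-- `∂f/∂ξ (L)` exists and equals `y`. -/
def HasPartialDeriv (f : (D.ParamIdx → ℝ) → ℝ) (y : ℝ) (L : D.ParamIdx → ℝ) (ξ : D.ParamIdx) :
    Prop :=
  HasDerivAt (fun x : ℝ => f (Function.update L ξ x)) y (L ξ)

/-- The parameter vector `L` solves the system `∂E/∂κ_i = 0`, `∂E/∂λ_{i,j} = 0`
(all coordinates). -/
def SolvesSystem (L : D.ParamIdx → ℝ) : Prop :=
  ∀ ξ : D.ParamIdx, D.HasPartialDeriv D.totalError 0 L ξ

end Data

end Bezier

end

noncomputable section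
namespace Bezier

/-! ### An alternating binomial sum -/

/-! The constraints only concern control points near the ends of the segments. A one-sided
derivative of order `j` is a multiple of a `j`-th forward difference of the control points nearest
that end (`rightDeriv_of_eq_segment`, `leftDeriv_of_eq_segment`). By binomial inversion the
constraints say that the boundary control points come from the given end derivatives and from common
derivatives at the interior partition points. Those common derivatives are the free parameters
(`compatible_iff_exists_hasBoundary`).

For fixed parameters every segment is a separate least squares problem for its inner control points.
Its normal equations are solved with the inverse of the Gram matrix of the inner Bernstein
polynomials, which is the table `C`, and with the projections of the boundary Bernstein polynomials
onto the inner ones, whose coefficients are `K` (`sum_gram_mul_eq_of_innerPoint`). The formulas for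
`K` and for the first row of `C` are both Lagrange interpolation of a polynomial of degree at most
`N = m - k - l - 2` hidden in the Gram matrix (`gram_eq_gramPoly`,
`sum_alternating_choose_mul_eval_div`). The other rows of `C` follow because a tridiagonal operator
on the Bernstein basis is symmetric for the inner product (`gram_tridiagonal`), and `A(k) = B(m-l) =
0` cuts it down to the inner indices.

Orthogonality now gives Pythagoras twice. An admissible curve with parameters `L'` has error `E(L')`
plus the squared norm of its deviation from the computed curve (`sum_localError_eq`). Moreover `E`
is quadratic with positive definite quadratic part: Bernstein polynomials are linearly independent,
and the parameters can be read off the control points. Hence `E` has exactly one critical point `L`,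
and `E(L')` exceeds `E(L)` by a definite form in `L' - L`. Both excess terms vanish only for the
computed control points (`isSolution_iff`). -/

theorem sum_alternating_choose_mul_eval_eq_zero (N : ℕ) (q : Polynomial ℝ)
    (hq : q.natDegree < N) :
    ∑ e ∈ Finset.range (N + 1), (-1 : ℝ) ^ e * (N.choose e : ℝ) * q.eval (e : ℝ) = 0 := by
  -- Up to the sign `(-1)^N`, the sum is the `N`-th forward difference of `q` at 0.
  have h := congrFun (Polynomial.fwdDiff_iter_eq_zero_of_degree_lt hq) 0
  rw [fwdDiff_iter_eq_sum_shift] at h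
  simp only [Pi.zero_apply, zero_add, nsmul_eq_mul, mul_one, zsmul_eq_mul] at h
  have h2 := congrArg (fun y => (-1 : ℝ) ^ N * y) h
  simp only [mul_zero, Finset.mul_sum] at h2
  rw [← h2]
  refine Finset.sum_congr rfl fun e he => ?_
  have he' : e ≤ N := by simpa [Nat.lt_succ_iff] using he
  obtain ⟨f, rfl⟩ := Nat.exists_eq_add_of_le he'
  rw [Nat.add_sub_cancel_left]
  push_cast
  have : ((-1 : ℝ) ^ f) * (-1) ^ f = 1 := by rw [← mul_pow]; simp
  rw [pow_add]
  linear_combination (-(-1 : ℝ) ^ e * ((e + f).choose e : ℝ) * q.eval (e : ℝ)) * this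

/-- Partial fractions: `(-1)^e * N.choose e` is the residue of the right side at `x = -e`. By
Pascal's rule the sum for `N + 1` at `x` is the difference of the sums for `N` at `x` and at `x +
1`, which drives the induction. -/
theorem sum_alternating_choose_div (N : ℕ) :
    ∀ x : ℝ, (∀ i ≤ N, x + i ≠ 0) →
      ∑ e ∈ Finset.range (N + 1), (-1 : ℝ) ^ e * (N.choose e : ℝ) / (x + e)
        = N ! / ∏ i ∈ Finset.range (N + 1), (x + i) := by
  induction N with
  | zero => intro x _; simp
  | succ N ih =>
    intro x hx
    have h1 := ih x fun i hi => hx i (by omega)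
    have h2 := ih (x + 1) fun i hi => by
      have := hx (i + 1) (by omega)
      push_cast at this
      rwa [show x + 1 + (i : ℝ) = x + (i + 1) by ring]
    have key : ∑ e ∈ Finset.range (N + 1 + 1), (-1 : ℝ) ^ e * ((N + 1).choose e : ℝ) / (x + e)
        = ∑ e ∈ Finset.range (N + 1), (-1 : ℝ) ^ e * (N.choose e : ℝ) / (x + e)
          - ∑ e ∈ Finset.range (N + 1), (-1 : ℝ) ^ e * (N.choose e : ℝ) / (x + 1 + e) := by
      have split : ∑ e ∈ Finset.range (N + 1), (-1 : ℝ) ^ e * (N.choose e : ℝ) / (x + e)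
          = ∑ e ∈ Finset.range (N + 1), (-1 : ℝ) ^ (e + 1) * (N.choose (e + 1) : ℝ) /
            (x + ((e + 1 : ℕ) : ℝ)) + 1 / x := by
        have := Finset.sum_range_succ
          (fun e : ℕ => (-1 : ℝ) ^ e * (N.choose e : ℝ) / (x + e)) (N + 1)
        rw [Finset.sum_range_succ'] at this
        simpa using this.symm
      rw [split, Finset.sum_range_succ', add_sub_right_comm, ← Finset.sum_sub_distrib]
      congr 1
      · refine Finset.sum_congr rfl fun e _ => ?_
        rw [Nat.choose_succ_succ]
        push_cast
        rw [show x + 1 + (e : ℝ) = x + (e + 1) by ring]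
        ring
      · simp
    rw [key, h1, h2]
    have e1 : ∏ i ∈ Finset.range (N + 1 + 1), (x + (i : ℝ))
        = (∏ i ∈ Finset.range (N + 1), (x + (i : ℝ))) * (x + (N + 1)) := by
      rw [Finset.prod_range_succ]; push_cast; ring
    have e2 : ∏ i ∈ Finset.range (N + 1 + 1), (x + (i : ℝ))
        = (∏ i ∈ Finset.range (N + 1), (x + 1 + (i : ℝ))) * x := by
      rw [Finset.prod_range_succ']
      push_cast
      rw [add_zero]
      congr 1
      exact Finset.prod_congr rfl fun i _ => by ring
    have hP : ∏ i ∈ Finset.range (N + 1 + 1), (x + (i : ℝ)) ≠ 0 :=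
      Finset.prod_ne_zero_iff.2 fun i hi => hx i (by simp at hi; omega)
    have n1 : ∏ i ∈ Finset.range (N + 1), (x + (i : ℝ)) ≠ 0 := fun h => hP (by rw [e1, h, zero_mul])
    have n2 : ∏ i ∈ Finset.range (N + 1), (x + 1 + (i : ℝ)) ≠ 0 :=
      fun h => hP (by rw [e2, h, zero_mul])
    rw [Nat.factorial_succ, div_sub_div _ _ n1 n2, div_eq_div_iff (mul_ne_zero n1 n2) hP]
    have e3 := e1.symm.trans e2
    push_cast
    rw [e1]
    linear_combination (-(N ! : ℝ) * (∏ i ∈ Finset.range (N + 1), (x + (i : ℝ)))) * e3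

/-- Lagrange interpolation at the nodes `0, …, N`, evaluated at `-x`. In `p = p(-x) + (X + x) q` the
constant contributes the partial fraction sum, and `q` contributes an alternating sum that vanishes
because its degree is below `N`. -/
theorem sum_alternating_choose_mul_eval_div (N : ℕ) (p : Polynomial ℝ) (hp : p.natDegree ≤ N)
    (x : ℝ) (hx : ∀ i ≤ N, x + i ≠ 0) :
    ∑ e ∈ Finset.range (N + 1), (-1 : ℝ) ^ e * (N.choose e : ℝ) * p.eval (e : ℝ) / (x + e)
      = p.eval (-x) * N ! / ∏ i ∈ Finset.range (N + 1), (x + i) := by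
  have hdiv : p = Polynomial.C (p.eval (-x))
      + (Polynomial.X - Polynomial.C (-x)) * (p /ₘ (Polynomial.X - Polynomial.C (-x))) := by
    conv_lhs => rw [← Polynomial.modByMonic_add_div p (Polynomial.X - Polynomial.C (-x))]
    rw [Polynomial.modByMonic_X_sub_C_eq_C_eval]
  set q := p /ₘ (Polynomial.X - Polynomial.C (-x)) with hq
  have hqs : ∑ e ∈ Finset.range (N + 1), (-1 : ℝ) ^ e * (N.choose e : ℝ) * q.eval (e : ℝ) = 0 := by
    -- For `N = 0` no polynomial satisfies `natDegree < N`, so the quotient is shown to be zero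
    -- directly.
    rcases Nat.eq_zero_or_pos N with rfl | hN
    · have : q = 0 := by
        rw [hq, Polynomial.divByMonic_eq_zero_iff (Polynomial.monic_X_sub_C _),
          Polynomial.degree_X_sub_C]
        calc p.degree ≤ p.natDegree := Polynomial.degree_le_natDegree
          _ < 1 := by
            have : p.natDegree = 0 := by omega
            rw [this]; exact zero_lt_one
      simp [this]
    · apply sum_alternating_choose_mul_eval_eq_zero
      rw [hq, Polynomial.natDegree_divByMonic _ (Polynomial.monic_X_sub_C _),
        Polynomial.natDegree_X_sub_C]
      omega
  rw [mul_div_assoc, ← sum_alternating_choose_div N x hx, Finset.mul_sum, ← sub_eq_zero,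
    ← hqs, ← Finset.sum_sub_distrib]
  refine Finset.sum_congr rfl fun e he => ?_
  have hxe : x + e ≠ 0 := hx e (by simpa [Nat.lt_succ_iff] using he)
  have hpe : p.eval (e : ℝ) = p.eval (-x) + (e + x) * q.eval (e : ℝ) := by
    conv_lhs => rw [hdiv]
    simp
  rw [hpe]
  field_simp
  ring

/-! ### Inner products of Bernstein polynomials -/

/-- The inner product of `B^N_i` and `B^M_j` on `[0, 1]`. -/
def gram (N M i j : ℕ) : ℝ :=
  ((N : ℝ) + M + 1)⁻¹ * (((N + M).choose (i + j) : ℝ))⁻¹ * (N.choose i : ℝ) * (M.choose j : ℝ)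

theorem shiftedFactorial_eq_eval (c : ℝ) (j : ℕ) :
    shiftedFactorial c j = (ascPochhammer ℝ j).eval c := by
  induction j with
  | zero => simp [shiftedFactorial]
  | succ j ih =>
    rw [shiftedFactorial, Finset.prod_range_succ, ← shiftedFactorial, ih, ascPochhammer_succ_eval]

theorem factorial_mul_ascPochhammer_eval (n j : ℕ) :
    (n ! : ℝ) * (ascPochhammer ℝ j).eval ((n : ℝ) + 1) = ((n + j)! : ℝ) := by
  have h := Nat.factorial_mul_ascFactorial n j
  rw [← ascPochhammer_nat_eq_ascFactorial] at h
  rw [← h]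
  push_cast
  rfl

/-- The polynomial in `h - k - 1` that describes the dependence of `gram m m h (k + 1 + g)` on `h`,
where `m = N + k + l + 2`. -/
def gramPoly (k l N g : ℕ) : Polynomial ℝ :=
  (ascPochhammer ℝ g).comp (Polynomial.X + Polynomial.C (2 * k + 3 : ℝ)) *
    (ascPochhammer ℝ (N - g)).comp (Polynomial.C (N + 2 * l + 3 : ℝ) - Polynomial.X)

theorem gramPoly_natDegree_le (k l N g : ℕ) (hg : g ≤ N) : (gramPoly k l N g).natDegree ≤ N := by
  refine Polynomial.natDegree_mul_le.trans ?_
  have h1 : (Polynomial.X + Polynomial.C (2 * k + 3 : ℝ)).natDegree ≤ 1 := by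
    rw [Polynomial.natDegree_X_add_C]
  have h2 : (Polynomial.C (N + 2 * l + 3 : ℝ) - Polynomial.X).natDegree ≤ 1 := by
    refine (Polynomial.natDegree_sub_le _ _).trans ?_
    rw [Polynomial.natDegree_C, Polynomial.natDegree_X]
    exact le_rfl
  refine (add_le_add Polynomial.natDegree_comp_le Polynomial.natDegree_comp_le).trans ?_
  rw [ascPochhammer_natDegree, ascPochhammer_natDegree]
  nlinarith [Nat.sub_add_cancel hg, Nat.zero_le g, Nat.zero_le (N - g)]

theorem gramPoly_eval (k l N g : ℕ) (x : ℝ) : (gramPoly k l N g).eval x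
    = (ascPochhammer ℝ g).eval (x + (2 * k + 3)) *
      (ascPochhammer ℝ (N - g)).eval (N + 2 * l + 3 - x) := by
  simp [gramPoly]

theorem inv_choose_div (m a b : ℕ) (h : a + b = m) :
    ((m : ℝ) + 1)⁻¹ * ((m.choose a : ℝ))⁻¹ = (a ! : ℝ) * b ! / (m + 1)! := by
  subst h
  rw [Nat.cast_add_choose, Nat.factorial_succ]
  have := Nat.factorial_ne_zero (a + b)
  have := Nat.factorial_ne_zero a
  have := Nat.factorial_ne_zero b
  push_cast
  field_simp

/-- The two factorials that mix `h` and `g` split as `(k + 1 + h)!` times a rising factorial of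
length `g`, and `(l + 1 + b)!` times one of length `N - g`. The joint dependence is therefore
polynomial in `h` of degree at most `N`, exactly what interpolation at `N + 1` nodes can handle. -/
theorem gram_eq_gramPoly (k l N m g h b : ℕ) (hm : m = N + k + l + 2) (hb : h + b = m)
    (hg : g ≤ N) :
    gram m m h (k + 1 + g) = (m.choose (k + 1 + g) : ℝ) / (2 * m + 1)! * (m.choose h : ℝ) *
      ((k + 1 + h)! : ℝ) * ((l + 1 + b)! : ℝ) *
      (gramPoly k l N g).eval ((h : ℝ) - (k + 1)) := by
  have h1 := inv_choose_div (m + m) (h + (k + 1 + g)) (l + 1 + b + (N - g)) (by omega)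
  have e1 := factorial_mul_ascPochhammer_eval (k + 1 + h) g
  have e2 := factorial_mul_ascPochhammer_eval (l + 1 + b) (N - g)
  rw [gram]
  push_cast at h1
  rw [h1, gramPoly_eval, show k + 1 + h + g = h + (k + 1 + g) by ring] at *
  rw [← e1, ← e2]
  have hbr : (h : ℝ) + b = N + k + l + 2 := by exact_mod_cast hb.trans hm
  have a1 : (h : ℝ) - (k + 1) + (2 * k + 3) = ((k + 1 + h : ℕ) : ℝ) + 1 := by push_cast; ring
  have a2 : (N : ℝ) + 2 * l + 3 - (h - (k + 1)) = ((l + 1 + b : ℕ) : ℝ) + 1 := by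
    push_cast; linear_combination -hbr
  rw [a1, a2, show m + m + 1 = 2 * m + 1 by ring]
  ring

/-! ### The coefficients `K_{j,h}` -/

/-- This makes `∑ K_{j,h} B_j` over inner `j` the orthogonal projection of the boundary polynomial
`B_h` onto the inner span. The factorials of `K` cancel those of the Gram entries, and what is left
interpolates `gramPoly` from `0, …, N` to `h - k - 1`, which is not a node since `h` is a boundary
index. -/
theorem sum_kCoeff_mul_gram (k l N m g h : ℕ) (hm : m = N + k + l + 2) (hg : g ≤ N) (hh : h ≤ m)
    (hout : h ≤ k ∨ m - l ≤ h) :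
    ∑ e ∈ Finset.range (N + 1), kCoeff m k l (k + 1 + e) h * gram m m (k + 1 + e) (k + 1 + g)
      = gram m m h (k + 1 + g) := by
  obtain ⟨b, hb⟩ := Nat.exists_eq_add_of_le hh
  have hx : ∀ i ≤ N, ((k : ℝ) + 1 - h) + i ≠ 0 := by
    intro i hi h0
    have : (k : ℝ) + 1 + i = h := by linarith
    have : k + 1 + i = h := by exact_mod_cast this
    omega
  have hprod : ∏ i ∈ Finset.range (N + 1), (((k : ℝ) + 1 - h) + i)
      = shiftedFactorial ((k : ℝ) + 1 - h) (N + 1) := rfl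
  have hprod0 : shiftedFactorial ((k : ℝ) + 1 - h) (N + 1) ≠ 0 := by
    rw [← hprod]
    exact Finset.prod_ne_zero_iff.2 fun i hi => hx i (by simp at hi; omega)
  have S := sum_alternating_choose_mul_eval_div N (gramPoly k l N g)
    (gramPoly_natDegree_le k l N g hg) _ hx
  rw [hprod] at S
  have sfac : ∀ a j : ℕ, shiftedFactorial ((a : ℝ) + 2) j = (a + 1 + j)! / (a + 1)! := by
    intro a j
    have h1 := factorial_mul_ascPochhammer_eval (a + 1) j
    rw [shiftedFactorial_eq_eval, eq_div_iff (by exact_mod_cast Nat.factorial_ne_zero _), ← h1]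
    push_cast
    rw [show (a : ℝ) + 1 + 1 = a + 2 by ring]
    ring
  have term : ∀ e ∈ Finset.range (N + 1),
      kCoeff m k l (k + 1 + e) h * gram m m (k + 1 + e) (k + 1 + g)
      = ((m.choose h : ℝ) * shiftedFactorial ((k : ℝ) + 1 - h) (N + 1) * (k + 1 + h)! *
          (l + 1 + b)! * ((m.choose (k + 1 + g) : ℝ) / (2 * m + 1)!) / N !) *
        ((-1 : ℝ) ^ e * (N.choose e : ℝ) * (gramPoly k l N g).eval (e : ℝ) /
          ((k : ℝ) + 1 - h + e)) := by
    intro e he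
    have he' : e ≤ N := by simpa [Nat.lt_succ_iff] using he
    obtain ⟨f, hf⟩ := Nat.exists_eq_add_of_le he'
    rw [gram_eq_gramPoly k l N m g (k + 1 + e) (f + l + 1) hm (by omega) hg, kCoeff, sfac, sfac, sfac,
      sfac,
      show m - k - l - 1 = N + 1 by omega, show k + 1 + e - k - 1 = e by omega,
      show m - l - (k + 1 + e) - 1 = f by omega, show m - (k + 1 + e) = f + l + 1 by omega,
      show m - h = b by omega]
    have hc : (m.choose (k + 1 + e) : ℝ) ≠ 0 := by
      exact_mod_cast (Nat.choose_pos (by omega : k + 1 + e ≤ m)).ne'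
    have hN : (N.choose e : ℝ) = N ! / (e ! * f !) := by
      rw [hf, Nat.cast_add_choose]
    rw [hN]
    have hd : ((k + 1 + e : ℕ) : ℝ) - h = (k : ℝ) + 1 - h + e := by push_cast; ring
    have hd2 : ((k + 1 + e : ℕ) : ℝ) - (k + 1) = e := by push_cast; ring
    rw [hd, hd2]
    have := hx e he'
    have F : ∀ n : ℕ, (n ! : ℝ) ≠ 0 := fun n => by exact_mod_cast Nat.factorial_ne_zero n
    have := F e
    have := F f
    have := F N
    have := F (k + 1)
    have := F (l + 1)
    have := F (k + 1 + (k + 1 + e))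
    have := F (l + 1 + (f + l + 1))
    have := F (2 * m + 1)
    field_simp
  rw [Finset.sum_congr rfl term, ← Finset.mul_sum, S,
    gram_eq_gramPoly k l N m g h b hm hb.symm hg,
    show -((k : ℝ) + 1 - h) = h - (k + 1) by ring]
  have : (N ! : ℝ) ≠ 0 := by exact_mod_cast Nat.factorial_ne_zero N
  field_simp

/-! ### The first row of the `C`-table -/

/-- Closed form of the recursive row, with `f` counting from its right end and `e` from its left
end. The first factor is constant along the row, so only quotients of neighbouring terms need to be
compared. -/
theorem cFirst_eq (k l N m : ℕ) (hm : m = N + k + l + 2) :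
    ∀ f e : ℕ, e + f = N → cFirst m k l f =
      (((N + 2 * k + 2 * l + 5)! : ℝ) * (2 * k + 3 + N)! /
        ((m.choose (k + 1) : ℝ) * N ! * (2 * k + 2)!)) *
      ((-1) ^ e * (N.choose f : ℝ) /
        ((m.choose (l + 1 + f) : ℝ) * (2 * k + 3 + e)! * (f + 2 * l + 2)!)) := by
  have F : ∀ n : ℕ, (n ! : ℝ) ≠ 0 := fun n => by exact_mod_cast Nat.factorial_ne_zero n
  have C : ∀ n ≤ m, (m.choose n : ℝ) ≠ 0 := fun n hn => by
    exact_mod_cast (Nat.choose_pos hn).ne'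
  intro f
  induction f with
  | zero =>
    intro e he
    obtain rfl : e = N := by omega
    rw [cFirst, show m - k - l - 2 = e by omega,
      show m + k + l + 3 = e + 2 * k + 2 * l + 5 by omega]
    have := F e
    have := F (2 * k + 2)
    have := F (2 * l + 2)
    have := F (2 * k + 3 + e)
    have := C (k + 1) (by omega)
    have := C (l + 1) (by omega)
    simp only [Nat.choose_zero_right, zero_add, add_zero]
    field_simp
    simp
  | succ f ih =>
    intro e he
    rw [cFirst, ih (e + 1) (by omega)]
    have hmr : (m : ℝ) = e + f + 1 + k + l + 2 := by
      rw [hm, ← he]; push_cast; ring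
    have c1 : (N.choose (f + 1) : ℝ) * (f + 1) = N.choose f * (e + 1) := by
      have := Nat.choose_succ_right_eq N f
      rw [show N - f = e + 1 by omega] at this
      exact_mod_cast this
    have c2 : (m.choose (l + 1 + f + 1) : ℝ) * (l + 1 + f + 1)
        = m.choose (l + 1 + f) * (k + 2 + e) := by
      have := Nat.choose_succ_right_eq m (l + 1 + f)
      rw [show m - (l + 1 + f) = k + 2 + e by omega] at this
      exact_mod_cast this
    have d1 : ((2 * k + 3 + (e + 1))! : ℝ) = (2 * k + 4 + e) * (2 * k + 3 + e)! := by
      rw [← add_assoc, Nat.factorial_succ]; push_cast; ring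
    have d2 : ((f + 1 + 2 * l + 2)! : ℝ) = (f + 2 * l + 3) * (f + 2 * l + 2)! := by
      rw [show f + 1 + 2 * l + 2 = f + 2 * l + 2 + 1 by ring, Nat.factorial_succ]; push_cast; ring
    -- The difference of squares factors as `(f + 1) * (f + 2 * l + 3)`, which makes both
    -- denominators visibly nonzero.
    have hr : (((m : ℝ) - l - 1 - (f + 1) - m) * ((m : ℝ) - l - 1 - (f + 1) - k) *
        ((m : ℝ) - l - 1 - (f + 1) + k + 3)) /
        (((m : ℝ) - l - 1 - (f + 1) + 1) * (((m : ℝ) - l - 1 - (f + 1) - m) ^ 2 - (l + 1) ^ 2))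
        = -((l + 2 + f) * (e + 1) * (2 * k + 4 + e)) /
          ((k + 2 + e) * ((f + 1) * (f + 2 * l + 3))) := by
      rw [hmr]
      congr 1 <;> ring
    simp only [hr]
    rw [d1, d2, ← add_assoc (l + 1) f 1]
    have hf1 : (f : ℝ) + 1 ≠ 0 := by positivity
    have hl1 : (l : ℝ) + 1 + f + 1 ≠ 0 := by positivity
    have c1' : (N.choose (f + 1) : ℝ) = N.choose f * (e + 1) / (f + 1) := by
      rw [eq_div_iff hf1, c1]
    have c2' : (m.choose (l + 1 + f + 1) : ℝ)
        = m.choose (l + 1 + f) * (k + 2 + e) / (l + 1 + f + 1) := by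
      rw [eq_div_iff hl1, c2]
    rw [c1', c2']
    have := F (2 * k + 3 + e)
    have := F (f + 2 * l + 2)
    have := C (l + 1 + f) (by omega)
    have : (k : ℝ) + 2 + e ≠ 0 := by positivity
    have : (f : ℝ) + 2 * l + 3 ≠ 0 := by positivity
    have : (2 : ℝ) * k + 4 + e ≠ 0 := by positivity
    rw [mul_left_comm]
    congr 1
    field_simp
    ring

theorem sum_inner_eq {M : Type*} [AddCommMonoid M] (k l N m : ℕ) (hm : m = N + k + l + 2)
    (f : ℕ → M) :
    ∑ h ∈ Finset.Icc (k + 1) (m - l - 1), f h = ∑ e ∈ Finset.range (N + 1), f (k + 1 + e) := by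
  have : Finset.Icc (k + 1) (m - l - 1) = Finset.Ico (k + 1) (k + 1 + (N + 1)) := by
    ext x; simp only [Finset.mem_Icc, Finset.mem_Ico]; omega
  rw [this, Finset.sum_Ico_eq_sum_range, Nat.add_sub_cancel_left]

theorem cRow_eq_zero (m k l a h : ℕ) (hh : ¬(k + 1 ≤ h ∧ h + l + 1 ≤ m)) :
    cRow m k l a h = 0 := by
  match a with
  | 0 => rfl
  | 1 => simp only [cRow, if_neg hh]
  | a + 2 => simp only [cRow, if_neg hh]

theorem sum_range_eq_inner (k l N m a : ℕ) (hm : m = N + k + l + 2) (f : ℕ → ℝ) :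
    ∑ h ∈ Finset.range (m + 1), cRow m k l a h * f h
      = ∑ e ∈ Finset.range (N + 1), cRow m k l a (k + 1 + e) * f (k + 1 + e) := by
  rw [← sum_inner_eq k l N m hm fun h => cRow m k l a h * f h]
  symm
  apply Finset.sum_subset
  · intro x; simp only [Finset.mem_Icc, Finset.mem_range]; omega
  · intro x _ hx
    rw [cRow_eq_zero, zero_mul]
    simp only [Finset.mem_Icc] at hx
    omega

/-- Interpolation again, now with `x = 2k + 3`: the factor `2k + 3 + e` is what survives of `(2k + 3
+ e)!` after cancellation against the Gram entry. At `-(2k + 3)` the polynomial `gramPoly` contains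
the rising factorial `(0)_g`, which is zero unless `g = 0`. -/
theorem first_row_mul_gram (k l N m g : ℕ) (hm : m = N + k + l + 2) (hg : g ≤ N) :
    ∑ h ∈ Finset.range (m + 1), cRow m k l 1 h * gram m m h (k + 1 + g)
      = if g = 0 then 1 else 0 := by
  have F : ∀ n : ℕ, (n ! : ℝ) ≠ 0 := fun n => by exact_mod_cast Nat.factorial_ne_zero n
  rw [sum_range_eq_inner k l N m 1 hm]
  have hx : ∀ i ≤ N, (2 * k + 3 : ℝ) + i ≠ 0 := fun i _ => by positivity
  have S := sum_alternating_choose_mul_eval_div N (gramPoly k l N g)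
    (gramPoly_natDegree_le k l N g hg) _ hx
  have hprod : ∏ i ∈ Finset.range (N + 1), ((2 * k + 3 : ℝ) + i)
      = (2 * k + 3 + N)! / (2 * k + 2)! := by
    rw [eq_div_iff (F _), mul_comm]
    have := factorial_mul_ascPochhammer_eval (2 * k + 2) (N + 1)
    rw [← shiftedFactorial_eq_eval, shiftedFactorial] at this
    rw [show 2 * k + 3 + N = 2 * k + 2 + (N + 1) by ring, ← this]
    push_cast
    rw [show (2 * k + 2 : ℝ) + 1 = 2 * k + 3 by ring]
  rw [hprod] at S
  have term : ∀ e ∈ Finset.range (N + 1),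
      cRow m k l 1 (k + 1 + e) * gram m m (k + 1 + e) (k + 1 + g)
      = (((N + 2 * k + 2 * l + 5)! : ℝ) * (2 * k + 3 + N)! /
        ((m.choose (k + 1) : ℝ) * N ! * (2 * k + 2)!) *
          ((m.choose (k + 1 + g) : ℝ) / (2 * m + 1)!)) *
        ((-1 : ℝ) ^ e * (N.choose e : ℝ) * (gramPoly k l N g).eval (e : ℝ) /
          ((2 * k + 3 : ℝ) + e)) := by
    intro e he
    have he' : e ≤ N := by simpa [Nat.lt_succ_iff] using he
    obtain ⟨f, hf⟩ := Nat.exists_eq_add_of_le he'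
    have hrow : cRow m k l 1 (k + 1 + e) = cFirst m k l f := by
      simp only [cRow]
      rw [if_pos (by omega), show m - l - 1 - (k + 1 + e) = f by omega]
    rw [gram_eq_gramPoly k l N m g (k + 1 + e) (f + l + 1) hm (by omega) hg, hrow,
      cFirst_eq k l N m hm f e hf.symm]
    have hd2 : ((k + 1 + e : ℕ) : ℝ) - (k + 1) = e := by push_cast; ring
    have hNe : N.choose f = N.choose e := by
      rw [hf, Nat.choose_symm_add]
    have hme : m.choose (l + 1 + f) = m.choose (k + 1 + e) := by
      rw [show m = k + 1 + e + (l + 1 + f) by omega, Nat.choose_symm_add]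
    have d1 : ((2 * k + 3 + e)! : ℝ) = (2 * k + 3 + e) * (k + 1 + (k + 1 + e))! := by
      rw [show 2 * k + 3 + e = k + 1 + (k + 1 + e) + 1 by ring, Nat.factorial_succ]
      push_cast; ring
    rw [hd2, hNe, hme, d1, show l + 1 + (f + l + 1) = f + 2 * l + 2 by ring]
    have hc : (m.choose (k + 1 + e) : ℝ) ≠ 0 := by
      exact_mod_cast (Nat.choose_pos (by omega : k + 1 + e ≤ m)).ne'
    have hc' : (m.choose (k + 1) : ℝ) ≠ 0 := by
      exact_mod_cast (Nat.choose_pos (by omega : k + 1 ≤ m)).ne'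
    have := hx e he'
    have := F N
    have := F (k + 1 + (k + 1 + e))
    have := F (f + 2 * l + 2)
    have := F (2 * m + 1)
    have := F (2 * k + 2)
    field_simp
  rw [Finset.sum_congr rfl term, ← Finset.mul_sum, S, gramPoly_eval]
  split_ifs with h0
  · subst h0
    have e1 := factorial_mul_ascPochhammer_eval (N + 2 * k + 2 * l + 5) N
    rw [show N + 2 * k + 2 * l + 5 + N = 2 * m + 1 by omega] at e1
    rw [← e1]
    have a2 : (N : ℝ) + 2 * l + 3 - -(2 * k + 3) = ((N + 2 * k + 2 * l + 5 : ℕ) : ℝ) + 1 := by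
      push_cast; ring
    rw [a2]
    have hP : (ascPochhammer ℝ N).eval (((N + 2 * k + 2 * l + 5 : ℕ) : ℝ) + 1) ≠ 0 := by
      intro h0
      rw [h0, mul_zero] at e1
      exact F _ e1.symm
    have hc' : (m.choose (k + 1) : ℝ) ≠ 0 := by
      exact_mod_cast (Nat.choose_pos (by omega : k + 1 ≤ m)).ne'
    have := F N
    have := F (2 * k + 3 + N)
    have := F (2 * k + 2)
    have := F (N + 2 * k + 2 * l + 5)
    simp only [add_zero, ascPochhammer_zero, Polynomial.eval_one, tsub_zero]
    field_simp
  · rw [neg_add_cancel, ascPochhammer_eval_zero, if_neg h0]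
    ring

/-! ### The recurrence for the rows -/

theorem gram_eq_factorial (m i b j d : ℕ) (hi : i + b = m) (hj : j + d = m) :
    gram m m i j = ((m ! : ℝ) ^ 2 / (2 * m + 1)!) * ((i + j)! * (b + d)!) /
      (i ! * b ! * (j ! * d !)) := by
  have h1 := inv_choose_div (m + m) (i + j) (b + d) (by omega)
  push_cast at h1
  rw [gram, h1, show m + m + 1 = 2 * m + 1 by ring]
  have e1 : (m.choose i : ℝ) = m ! / (i ! * b !) := by rw [← hi, Nat.cast_add_choose]
  have e2 : (m.choose j : ℝ) = m ! / (j ! * d !) := by rw [← hj, Nat.cast_add_choose]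
  rw [e1, e2]
  ring

/-- With `i = a + 1` and `j = c + 1`: the operator `B_i ↦ B(i+1) B_{i+1} + 2i(m-i) B_i + A(i-1)
B_{i-1}` is symmetric for the inner product. This is the source of the recurrence for `C`, because
`2(j-h)(j+h-m) = 2h(m-h) - 2j(m-j)`. Once common factorials are removed, a polynomial identity
modulo `a + b = c + d` remains. -/
theorem gram_tridiagonal (m k l a b c d : ℕ) (hab : a + b + 2 = m) (hcd : c + d + 2 = m) :
    cB m l ((a + 2 : ℕ) : ℝ) * gram m m (a + 2) (c + 1)
        + 2 * ((a + 1 : ℕ) : ℝ) * (m - ((a + 1 : ℕ) : ℝ)) * gram m m (a + 1) (c + 1)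
        + cA m k (a : ℝ) * gram m m a (c + 1)
      = cB m l ((c + 2 : ℕ) : ℝ) * gram m m (a + 1) (c + 2)
        + 2 * ((c + 1 : ℕ) : ℝ) * (m - ((c + 1 : ℕ) : ℝ)) * gram m m (a + 1) (c + 1)
        + cA m k (c : ℝ) * gram m m (a + 1) c := by
  have F : ∀ n : ℕ, (n ! : ℝ) ≠ 0 := fun n => by exact_mod_cast Nat.factorial_ne_zero n
  have hB : ∀ x y : ℕ, x + y + 2 = m → cB m l ((x + 2 : ℕ) : ℝ)
      = (x + 2) * (y + l + 2) * (l - y) / (y + 1) := by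
    intro x y h
    have hr : (m : ℝ) = x + y + 2 := by exact_mod_cast h.symm
    rw [cB, hr, ← neg_div_neg_eq]
    push_cast
    congr 1 <;> ring
  have hA : ∀ x y : ℕ, x + y + 2 = m → cA m k (x : ℝ)
      = -((y + 2) * (x - k) * (x + k + 2)) / (x + 1) := by
    intro x y h
    have hr : (m : ℝ) = x + y + 2 := by exact_mod_cast h.symm
    rw [cA, hr]
    congr 1; ring
  rw [hB a b hab, hB c d hcd, hA a b hab, hA c d hcd,
    gram_eq_factorial m (a + 2) b (c + 1) (d + 1) (by omega) (by omega),
    gram_eq_factorial m (a + 1) (b + 1) (c + 1) (d + 1) (by omega) (by omega),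
    gram_eq_factorial m a (b + 2) (c + 1) (d + 1) (by omega) (by omega),
    gram_eq_factorial m (a + 1) (b + 1) (c + 2) d (by omega) (by omega),
    gram_eq_factorial m (a + 1) (b + 1) c (d + 2) (by omega) (by omega)]
  have hmr : (m : ℝ) = a + b + 2 := by exact_mod_cast hab.symm
  have hdr : (d : ℝ) = a + b - c := by
    have : (c : ℝ) + d + 2 = m := by exact_mod_cast hcd
    linarith
  rw [show a + 2 + (c + 1) = a + c + 1 + 1 + 1 by ring, show b + (d + 1) = b + d + 1 by ring,
    show a + 1 + (c + 1) = a + c + 1 + 1 by ring, show b + 1 + (d + 1) = b + d + 1 + 1 by ring,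
    show a + (c + 1) = a + c + 1 by ring, show b + 2 + (d + 1) = b + d + 1 + 1 + 1 by ring,
    show a + 1 + (c + 2) = a + c + 1 + 1 + 1 by ring, show b + 1 + d = b + d + 1 by ring,
    show a + 1 + c = a + c + 1 by ring, show b + 1 + (d + 2) = b + d + 1 + 1 + 1 by ring,
    show a + 2 = a + 1 + 1 by ring, show b + 2 = b + 1 + 1 by ring,
    show c + 2 = c + 1 + 1 by ring, show d + 2 = d + 1 + 1 by ring]
  simp only [Nat.factorial_succ]
  push_cast
  rw [hmr]
  have := F a
  have := F b
  have := F c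
  have := F d
  have := F (a + c)
  have := F (b + d)
  have := F (2 * m)
  have : (b : ℝ) + 1 ≠ 0 := by positivity
  have : (b : ℝ) + 1 + 1 ≠ 0 := by positivity
  have : (a : ℝ) + 1 ≠ 0 := by positivity
  have : (a : ℝ) + 1 + 1 ≠ 0 := by positivity
  have : (c : ℝ) + 1 ≠ 0 := by positivity
  have : (c : ℝ) + 1 + 1 ≠ 0 := by positivity
  have : (d : ℝ) + 1 ≠ 0 := by positivity
  have : (d : ℝ) + 1 + 1 ≠ 0 := by positivity
  have : (2 : ℝ) * (a + b + 2) + 1 ≠ 0 := by positivity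
  field_simp
  rw [hdr]
  ring

/-- Here and in `cB_sub`, the coefficients that would lead out of the inner range vanish, so the
tridiagonal operator restricts to the inner indices. -/
theorem cA_self (m k : ℕ) : cA m k (k : ℝ) = 0 := by simp [cA]

theorem cB_sub (m l : ℕ) (hl : l ≤ m) : cB m l ((m - l : ℕ) : ℝ) = 0 := by
  rw [cB, Nat.cast_sub hl]; simp

theorem cA_ne_zero (m k j : ℕ) (hk : k < j) (hm : j < m) : cA m k (j : ℝ) ≠ 0 := by
  have h1 : (k : ℝ) < j := by exact_mod_cast hk
  have h2 : (j : ℝ) < m := by exact_mod_cast hm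
  have : (j : ℝ) + 1 ≠ 0 := by positivity
  have : (j : ℝ) + k + 2 ≠ 0 := by positivity
  have : (j : ℝ) - k ≠ 0 := sub_ne_zero.2 h1.ne'
  have : (j : ℝ) - m ≠ 0 := sub_ne_zero.2 h2.ne
  rw [cA]
  positivity

/-- Valid for all `h`, also where the row is zero by convention: there, the only neighbours that may
be nonzero carry the factor `A(k)` or `B(m-l)`. This allows summation over all of `0, …, m` without
boundary terms. -/
theorem cRow_recurrence (m k l a h : ℕ) (ha : k + a + l + 3 ≤ m) :
    cA m k ((k + a + 1 : ℕ) : ℝ) * cRow m k l (a + 2) h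
      = 2 * (((k + a + 1 : ℕ) : ℝ) - h) * (((k + a + 1 : ℕ) : ℝ) + h - m) * cRow m k l (a + 1) h
        + cB m l h * cRow m k l (a + 1) (h - 1) + cA m k h * cRow m k l (a + 1) (h + 1)
        - cB m l ((k + a + 1 : ℕ) : ℝ) * cRow m k l a h := by
  by_cases hh : k + 1 ≤ h ∧ h + l + 1 ≤ m
  · have hA := cA_ne_zero m k (k + a + 1) (by omega) (by omega)
    push_cast at hA ⊢
    rw [cRow]
    simp only [if_pos hh]
    rw [← mul_assoc, mul_one_div_cancel hA, one_mul]
  · rw [cRow_eq_zero m k l (a + 2) h hh, cRow_eq_zero m k l (a + 1) h hh,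
      cRow_eq_zero m k l a h hh]
    have h1 : cB m l h * cRow m k l (a + 1) (h - 1) = 0 := by
      by_cases h' : h = m - l
      · rw [h', cB_sub m l (by omega), zero_mul]
      · rw [cRow_eq_zero, mul_zero]; omega
    have h2 : cA m k h * cRow m k l (a + 1) (h + 1) = 0 := by
      by_cases h' : h = k
      · rw [h', cA_self, zero_mul]
      · rw [cRow_eq_zero, mul_zero]; omega
    rw [h1, h2]; ring

/-- Pair the recurrence with a Gram column. Shifting the summation index puts the tridiagonal
operator on the row index of the Gram matrix, and its symmetry moves it to the column index. -/
theorem row_succ_mul_gram (k l m a g : ℕ) (ha : k + a + l + 3 ≤ m)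
    (hg' : g + l + 2 ≤ m) :
    cA m k ((k + a + 1 : ℕ) : ℝ) *
        ∑ h ∈ Finset.range (m + 1), cRow m k l (a + 2) h * gram m m h (g + 1)
      = cB m l ((g + 2 : ℕ) : ℝ) *
          ∑ h ∈ Finset.range (m + 1), cRow m k l (a + 1) h * gram m m h (g + 2)
        + 2 * (((k + a + 1 : ℕ) : ℝ) - ((g + 1 : ℕ) : ℝ)) *
          (((k + a + 1 : ℕ) : ℝ) + ((g + 1 : ℕ) : ℝ) - m) *
          ∑ h ∈ Finset.range (m + 1), cRow m k l (a + 1) h * gram m m h (g + 1)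
        + cA m k (g : ℝ) * ∑ h ∈ Finset.range (m + 1), cRow m k l (a + 1) h * gram m m h g
        - cB m l ((k + a + 1 : ℕ) : ℝ) *
          ∑ h ∈ Finset.range (m + 1), cRow m k l a h * gram m m h (g + 1) := by
  set j := k + a + 1 with hj
  -- Nothing is lost in the shift: `B(0) = 0`, and the row vanishes at `m`. In `s2` the truncated `h
  -- - 1` at `h = 0` is harmless because the row vanishes there.
  have s1 : ∑ h ∈ Finset.range (m + 1), cB m l h * cRow m k l (a + 1) (h - 1) * gram m m h (g + 1)
      = ∑ h ∈ Finset.range (m + 1),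
          cB m l ((h + 1 : ℕ) : ℝ) * cRow m k l (a + 1) h * gram m m (h + 1) (g + 1) := by
    rw [Finset.sum_range_succ', Finset.sum_range_succ _ m, cRow_eq_zero m k l (a + 1) m (by omega)]
    simp [cB]
  have s2 : ∑ h ∈ Finset.range (m + 1), cA m k h * cRow m k l (a + 1) (h + 1) * gram m m h (g + 1)
      = ∑ h ∈ Finset.range (m + 1),
          cA m k ((h - 1 : ℕ) : ℝ) * cRow m k l (a + 1) h * gram m m (h - 1) (g + 1) := by
    rw [Finset.sum_range_succ, Finset.sum_range_succ' _ m,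
      cRow_eq_zero m k l (a + 1) 0 (by omega), cRow_eq_zero m k l (a + 1) (m + 1) (by omega)]
    simp
  have e1 : cA m k (j : ℝ) * ∑ h ∈ Finset.range (m + 1), cRow m k l (a + 2) h * gram m m h (g + 1)
      = ∑ h ∈ Finset.range (m + 1), 2 * ((j : ℝ) - h) * ((j : ℝ) + h - m) *
            cRow m k l (a + 1) h * gram m m h (g + 1)
        + ∑ h ∈ Finset.range (m + 1), cB m l h * cRow m k l (a + 1) (h - 1) * gram m m h (g + 1)
        + ∑ h ∈ Finset.range (m + 1), cA m k h * cRow m k l (a + 1) (h + 1) * gram m m h (g + 1)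
        - ∑ h ∈ Finset.range (m + 1), cB m l j * cRow m k l a h * gram m m h (g + 1) := by
    rw [Finset.mul_sum, ← Finset.sum_add_distrib, ← Finset.sum_add_distrib,
      ← Finset.sum_sub_distrib]
    refine Finset.sum_congr rfl fun h _ => ?_
    rw [← mul_assoc, cRow_recurrence m k l a h ha]
    ring
  rw [e1, s1, s2]
  simp only [Finset.mul_sum]
  rw [← Finset.sum_add_distrib, ← Finset.sum_add_distrib, ← Finset.sum_sub_distrib,
    ← Finset.sum_add_distrib, ← Finset.sum_add_distrib, ← Finset.sum_sub_distrib]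
  refine Finset.sum_congr rfl fun h _ => ?_
  by_cases hh : k + 1 ≤ h ∧ h + l + 1 ≤ m
  · obtain ⟨x, rfl⟩ : ∃ x, h = x + 1 := ⟨h - 1, by omega⟩
    have T := gram_tridiagonal m k l x (m - 2 - x) g (m - 2 - g) (by omega) (by omega)
    rw [Nat.add_sub_cancel]
    linear_combination cRow m k l (a + 1) (x + 1) * T
  · rw [cRow_eq_zero m k l (a + 1) h hh]
    ring

/-- Two consecutive rows determine the next one, and the Kronecker delta obeys the same recurrence.
The column is written `g + 1` so that its left neighbour needs no subtraction. -/
theorem row_mul_gram (k l N m : ℕ) (hm : m = N + k + l + 2) :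
    ∀ a ≤ N + 1, ∀ g, k ≤ g → g + l + 2 ≤ m →
      ∑ h ∈ Finset.range (m + 1), cRow m k l a h * gram m m h (g + 1)
        = if k + a = g + 1 then 1 else 0 := by
  intro a
  induction a using Nat.twoStepInduction with
  | zero =>
    intro _ g hg _
    rw [if_neg (by omega)]
    simp [cRow]
  | one =>
    intro _ g hg hg'
    obtain ⟨c, rfl⟩ := Nat.exists_eq_add_of_le hg
    have := first_row_mul_gram k l N m c hm (by omega)
    rw [show k + c + 1 = k + 1 + c by ring, this]
    congr 1
    exact propext (by omega)
  | more a ih1 ih2 =>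
    intro ha g hg hg'
    have hA := cA_ne_zero m k (k + a + 1) (by omega) (by omega)
    apply mul_left_cancel₀ hA
    rw [row_succ_mul_gram k l m a g (by omega) hg', ih2 (by omega) g hg hg',
      ih1 (by omega) g hg hg']
    -- The induction hypothesis does not cover column `m - l`, but its coefficient is `B(m-l) = 0`;
    -- column `k` in `t2` is excused by `A(k) = 0`.
    have t1 : cB m l ((g + 2 : ℕ) : ℝ) *
        ∑ h ∈ Finset.range (m + 1), cRow m k l (a + 1) h * gram m m h (g + 2)
        = cB m l ((g + 2 : ℕ) : ℝ) * if k + a = g + 1 then 1 else 0 := by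
      by_cases h : g + 2 = m - l
      · rw [h, cB_sub m l (by omega), zero_mul, zero_mul]
      · rw [ih2 (by omega) (g + 1) (by omega) (by omega)]
        congr 2
        exact propext (by omega)
    have t2 : cA m k (g : ℝ) * ∑ h ∈ Finset.range (m + 1), cRow m k l (a + 1) h * gram m m h g
        = cA m k (g : ℝ) * if k + a + 1 = g then 1 else 0 := by
      by_cases h : g = k
      · rw [h, cA_self, zero_mul, zero_mul]
      · obtain ⟨x, rfl⟩ : ∃ x, g = x + 1 := ⟨g - 1, by omega⟩
        rw [ih2 (by omega) x (by omega) (by omega)]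
        rfl
    rw [t1, t2]
    -- With `j = k + a + 1`: to the right of the diagonal only `A(g) = A(j)` can survive, on it the
    -- coefficient `2(j-(g+1))(…)` vanishes, and to the left the two terms with `B(j)` cancel.
    rcases lt_trichotomy (k + a) g with h | h | h
    · rw [if_neg (by omega), if_neg (by omega), mul_zero, mul_zero, mul_zero]
      by_cases h' : k + a + 1 = g
      · rw [if_pos h', if_pos (by omega), h']; ring
      · rw [if_neg h', if_neg (by omega)]; ring
    · rw [if_neg (by omega), if_pos (by omega), if_neg (by omega), if_neg (by omega), ← h]
      ring
    · rw [if_neg (by omega : ¬ k + (a + 1) = g + 1), if_neg (by omega : ¬ k + a + 1 = g),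
        if_neg (by omega : ¬ k + (a + 2) = g + 1)]
      by_cases h' : k + a = g + 1
      · rw [if_pos h', h']; ring
      · rw [if_neg h']; ring

theorem cTable_mul_gram (k l N m j g : ℕ) (hm : m = N + k + l + 2)
    (hj : k + 1 ≤ j ∧ j ≤ m - l - 1) (hg : k + 1 ≤ g ∧ g ≤ m - l - 1) :
    ∑ h ∈ Finset.Icc (k + 1) (m - l - 1), cTable m k l j h * gram m m h g
      = if j = g then 1 else 0 := by
  obtain ⟨x, rfl⟩ : ∃ x, g = x + 1 := ⟨g - 1, by omega⟩
  have := row_mul_gram k l N m hm (j - k) (by omega) x (by omega) (by omega)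
  rw [sum_range_eq_inner k l N m _ hm] at this
  rw [sum_inner_eq k l N m hm]
  have hj' : k + 1 ≤ j ∧ j + l + 1 ≤ m := by omega
  simp only [cTable, if_pos hj']
  rw [this, Nat.add_sub_cancel' (by omega)]

/-! ### Integrals of Bernstein polynomials -/

theorem integral_pow_mul_one_sub_pow (b : ℕ) : ∀ a : ℕ,
    ∫ u in (0 : ℝ)..1, u ^ a * (1 - u) ^ b = (a ! * b ! : ℝ) / (a + b + 1)! := by
  induction b with
  | zero =>
    intro a
    have : ((a : ℝ) + 1) ≠ 0 := by positivity
    have : (a ! : ℝ) ≠ 0 := by exact_mod_cast Nat.factorial_ne_zero a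
    simp [Nat.factorial_succ]
    field_simp
  | succ b ih =>
    intro a
    have e : ∀ u : ℝ, u ^ a * (1 - u) ^ (b + 1) = u ^ a * (1 - u) ^ b - u ^ (a + 1) * (1 - u) ^ b :=
      fun u => by ring
    simp only [e]
    rw [intervalIntegral.integral_sub (Continuous.intervalIntegrable (by fun_prop) _ _)
      (Continuous.intervalIntegrable (by fun_prop) _ _), ih, ih,
      show a + 1 + b + 1 = a + b + 1 + 1 by ring, show a + (b + 1) + 1 = a + b + 1 + 1 by ring,
      Nat.factorial_succ (a + b + 1), Nat.factorial_succ a, Nat.factorial_succ b]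
    have : ((a + b + 1)! : ℝ) ≠ 0 := by exact_mod_cast Nat.factorial_ne_zero _
    push_cast
    have : (a : ℝ) + b + 1 + 1 ≠ 0 := by positivity
    field_simp
    ring

theorem continuous_bern (N j : ℕ) : Continuous (bern N j) := by
  unfold bern; fun_prop

theorem integral_bern_mul_bern (N M i j : ℕ) (hi : i ≤ N) (hj : j ≤ M) :
    ∫ u in (0 : ℝ)..1, bern N i u * bern M j u = gram N M i j := by
  have e : ∀ u : ℝ, bern N i u * bern M j u
      = ((N.choose i : ℝ) * M.choose j) * (u ^ (i + j) * (1 - u) ^ (N - i + (M - j))) := fun u => by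
    rw [bern, bern]; ring
  simp only [e]
  have h1 := inv_choose_div (N + M) (i + j) (N - i + (M - j)) (by omega)
  rw [intervalIntegral.integral_const_mul, integral_pow_mul_one_sub_pow,
    show i + j + (N - i + (M - j)) + 1 = N + M + 1 by omega, ← h1, gram]
  push_cast
  ring

theorem integral_dualBern_mul_bern (m k l : ℕ) (hm : k + l + 1 < m) (j h : ℕ)
    (hj : j ∈ Finset.Icc (k + 1) (m - l - 1)) (hh : h ∈ Finset.Icc (k + 1) (m - l - 1)) :
    ∫ u in (0 : ℝ)..1, dualBern m k l j u * bern m h u = if j = h then 1 else 0 := by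
  rw [Finset.mem_Icc] at hj hh
  rw [← cTable_mul_gram k l (m - k - l - 2) m j h (by omega) hj hh]
  simp only [dualBern, Finset.sum_mul]
  rw [intervalIntegral.integral_finsetSum]
  · refine Finset.sum_congr rfl fun i hi => ?_
    rw [Finset.mem_Icc] at hi
    simp only [mul_assoc]
    rw [intervalIntegral.integral_const_mul,
      integral_bern_mul_bern m m i h (by omega) (by omega)]
  · intro i _
    have := continuous_bern m i
    have := continuous_bern m h
    exact Continuous.intervalIntegrable (by fun_prop) _ _

/-! ### The bilinear form `I_{N,M}` -/

theorem iForm_eq_sum_gram (N M : ℕ) (x y : ℕ → ℝ) : iForm N M x y =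
    ∑ i ∈ Finset.range (N + 1), ∑ j ∈ Finset.range (M + 1), gram N M i j * x i * y j := by
  simp only [iForm, gram, Finset.mul_sum]
  refine Finset.sum_congr rfl fun i _ => Finset.sum_congr rfl fun j _ => ?_
  ring

theorem integral_sum_mul_sum (N M : ℕ) (x y : ℕ → ℝ) :
    ∫ u in (0 : ℝ)..1, (∑ i ∈ Finset.range (N + 1), bern N i u * x i) *
      (∑ j ∈ Finset.range (M + 1), bern M j u * y j) = iForm N M x y := by
  have hc := continuous_bern
  simp only [Finset.sum_mul_sum]
  rw [iForm_eq_sum_gram, intervalIntegral.integral_finsetSum]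
  · refine Finset.sum_congr rfl fun i hi => ?_
    rw [intervalIntegral.integral_finsetSum]
    · refine Finset.sum_congr rfl fun j hj => ?_
      rw [← integral_bern_mul_bern N M i j (by simpa [Nat.lt_succ_iff] using hi)
        (by simpa [Nat.lt_succ_iff] using hj), mul_assoc, ← intervalIntegral.integral_mul_const]
      congr 1
      ext u
      ring
    · intro j _
      exact Continuous.intervalIntegrable (by fun_prop) _ _
  · intro i _
    exact Continuous.intervalIntegrable (by fun_prop) _ _

theorem iForm_add_right (N M : ℕ) (x y z : ℕ → ℝ) :
    iForm N M x (fun j => y j + z j) = iForm N M x y + iForm N M x z := by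
  simp only [iForm_eq_sum_gram, mul_add, Finset.sum_add_distrib]

theorem iForm_add_left (N M : ℕ) (x y z : ℕ → ℝ) :
    iForm N M (fun j => x j + y j) z = iForm N M x z + iForm N M y z := by
  simp only [iForm_eq_sum_gram, mul_add, add_mul, Finset.sum_add_distrib]

theorem iForm_smul_right (N M : ℕ) (c : ℝ) (x y : ℕ → ℝ) :
    iForm N M x (fun j => c * y j) = c * iForm N M x y := by
  simp only [iForm_eq_sum_gram, Finset.mul_sum]
  refine Finset.sum_congr rfl fun i _ => Finset.sum_congr rfl fun j _ => ?_
  ring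

theorem iForm_smul_left (N M : ℕ) (c : ℝ) (x y : ℕ → ℝ) :
    iForm N M (fun j => c * x j) y = c * iForm N M x y := by
  simp only [iForm_eq_sum_gram, Finset.mul_sum]
  refine Finset.sum_congr rfl fun i _ => Finset.sum_congr rfl fun j _ => ?_
  ring

theorem iForm_comm (N : ℕ) (x y : ℕ → ℝ) : iForm N N x y = iForm N N y x := by
  rw [← integral_sum_mul_sum, ← integral_sum_mul_sum]
  simp only [mul_comm]

theorem iForm_self_nonneg (N : ℕ) (x : ℕ → ℝ) : 0 ≤ iForm N N x x := by
  rw [← integral_sum_mul_sum]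
  exact intervalIntegral.integral_nonneg zero_le_one fun u _ => mul_self_nonneg _

/-- Substituting `u = t / (1 + t)` and multiplying by `(1 + t)^N` turns the Bernstein sum into `∑
N.choose i * x i * t^i`. It vanishes for all `t ≥ 0`, so its coefficients are zero. -/
theorem eq_zero_of_sum_bern_eq_zero (N : ℕ) (x : ℕ → ℝ)
    (h : ∀ u ∈ Set.Icc (0 : ℝ) 1, ∑ i ∈ Finset.range (N + 1), bern N i u * x i = 0) :
    ∀ j ≤ N, x j = 0 := by
  set p : Polynomial ℝ :=
    ∑ i ∈ Finset.range (N + 1), Polynomial.C ((N.choose i : ℝ) * x i) * Polynomial.X ^ i with hp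
  have hroot : ∀ t : ℝ, 0 ≤ t → p.eval t = 0 := by
    intro t ht
    have h1 : (1 + t) ≠ 0 := by positivity
    have := h (t / (1 + t)) ⟨by positivity, by rw [div_le_one (by positivity)]; linarith⟩
    have h2 : p.eval t
        = (1 + t) ^ N * ∑ i ∈ Finset.range (N + 1), bern N i (t / (1 + t)) * x i := by
      rw [hp, Polynomial.eval_finsetSum, Finset.mul_sum]
      refine Finset.sum_congr rfl fun i hi => ?_
      obtain ⟨f, rfl⟩ := Nat.exists_eq_add_of_le
        (show i ≤ N by simpa [Nat.lt_succ_iff] using hi)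
      rw [bern, Nat.add_sub_cancel_left, show 1 - t / (1 + t) = 1 / (1 + t) by field_simp; ring,
        div_pow, div_pow, pow_add]
      simp only [Polynomial.eval_mul, Polynomial.eval_C, Polynomial.eval_pow, Polynomial.eval_X]
      field_simp
      simp
    rw [h2, this, mul_zero]
  have hp0 : p = 0 := by
    apply Polynomial.eq_zero_of_infinite_isRoot
    exact (Set.Ici_infinite (0 : ℝ)).mono fun t ht => hroot t ht
  intro j hj
  have := congrArg (fun q => Polynomial.coeff q j) hp0
  simp only [hp, Polynomial.finsetSum_coeff, Polynomial.coeff_C_mul_X_pow,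
    Polynomial.coeff_zero] at this
  rw [Finset.sum_ite_eq, if_pos (by simp; omega)] at this
  exact (mul_eq_zero.1 this).resolve_left (by exact_mod_cast (Nat.choose_pos hj).ne')

theorem eq_zero_of_iForm_self_eq_zero (N : ℕ) (x : ℕ → ℝ) (h : iForm N N x x = 0) :
    ∀ j ≤ N, x j = 0 := by
  apply eq_zero_of_sum_bern_eq_zero
  intro u hu
  by_contra hne
  rw [← integral_sum_mul_sum] at h
  have hc := continuous_bern N
  refine absurd h (ne_of_gt ?_)
  exact intervalIntegral.integral_pos zero_lt_one (Continuous.continuousOn (by fun_prop))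
    (fun _ _ => mul_self_nonneg _) ⟨u, hu, mul_self_pos.2 hne⟩

/-! ### Forward differences -/

section ForwardDifference

variable {E : Type*} [AddCommGroup E] [Module ℝ E]

theorem fwdDiff_iter_zero_eq_sum (w : ℕ → E) (j : ℕ) : (fwdDiff (1 : ℕ))^[j] w 0
    = ∑ h ∈ Finset.range (j + 1), ((-1 : ℝ) ^ (j - h) * (j.choose h : ℝ)) • w h := by
  rw [fwdDiff_iter_eq_sum_shift]
  refine Finset.sum_congr rfl fun h _ => ?_
  rw [← Int.cast_smul_eq_zsmul ℝ]
  simp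

theorem eq_sum_fwdDiff_iter_zero (w : ℕ → E) (j : ℕ) :
    w j = ∑ h ∈ Finset.range (j + 1), (j.choose h : ℝ) • (fwdDiff (1 : ℕ))^[h] w 0 := by
  have := shift_eq_sum_fwdDiff_iter (1 : ℕ) w j 0
  simp only [smul_eq_mul, mul_one, zero_add] at this
  rw [this]
  simp only [Nat.cast_smul_eq_nsmul]

/-- Values and differences determine one another triangularly. This exchanges derivative conditions
for prescribed boundary control points. -/
theorem fwdDiff_iter_zero_congr_iff (w w' : ℕ → E) (r : ℕ) :
    (∀ j ≤ r, (fwdDiff (1 : ℕ))^[j] w 0 = (fwdDiff (1 : ℕ))^[j] w' 0) ↔ ∀ j ≤ r, w j = w' j := by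
  constructor
  · intro h j hj
    rw [eq_sum_fwdDiff_iter_zero w, eq_sum_fwdDiff_iter_zero w']
    refine Finset.sum_congr rfl fun i hi => ?_
    rw [h i (by simp at hi; omega)]
  · intro h j hj
    rw [fwdDiff_iter_zero_eq_sum w, fwdDiff_iter_zero_eq_sum w']
    refine Finset.sum_congr rfl fun i hi => ?_
    rw [h i (by simp at hi; omega)]

theorem fwdDiff_iter_zero_of_binomial (w c : ℕ → E)
    (h : ∀ j, w j = ∑ i ∈ Finset.range (j + 1), (j.choose i : ℝ) • c i) (j : ℕ) :
    (fwdDiff (1 : ℕ))^[j] w 0 = c j := by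
  induction j using Nat.strong_induction_on with
  | _ j ih =>
    have h1 := (eq_sum_fwdDiff_iter_zero w j).symm.trans (h j)
    rw [Finset.sum_range_succ, Finset.sum_range_succ _ j] at h1
    have h2 : ∑ i ∈ Finset.range j, (j.choose i : ℝ) • (fwdDiff (1 : ℕ))^[i] w 0
        = ∑ i ∈ Finset.range j, (j.choose i : ℝ) • c i :=
      Finset.sum_congr rfl fun i hi => by rw [ih i (by simpa using hi)]
    rw [h2] at h1
    simpa using add_left_cancel h1

/-- Left-hand derivatives involve differences at the far end of the control polygon; reversing the
polygon reduces them to differences at 0, at the cost of a sign. -/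
theorem fwdDiff_iter_reverse (w : ℕ → E) (m j : ℕ) (hj : j ≤ m) :
    (fwdDiff (1 : ℕ))^[j] (fun h => w (m - h)) 0
      = (-1 : ℝ) ^ j • (fwdDiff (1 : ℕ))^[j] w (m - j) := by
  rw [fwdDiff_iter_zero_eq_sum, fwdDiff_iter_eq_sum_shift, Finset.smul_sum,
    ← Finset.sum_range_reflect]
  refine Finset.sum_congr rfl fun i hi => ?_
  have hi' : i ≤ j := by simpa [Nat.lt_succ_iff] using hi
  obtain ⟨f, rfl⟩ := Nat.exists_eq_add_of_le hi'
  rw [← Int.cast_smul_eq_zsmul ℝ, smul_smul, show i + f + 1 - 1 - i = f by omega,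
    show i + f - f = i by omega, show i + f - i = f by omega,
    show m - (i + f) + i • 1 = m - f by simp; omega]
  congr 1
  have : ((-1 : ℝ) ^ f) * (-1) ^ f = 1 := by rw [← mul_pow]; simp
  rw [Nat.choose_symm_add]
  push_cast
  rw [pow_add]
  linear_combination (-(-1 : ℝ) ^ i * ((i + f).choose f : ℝ)) * this

end ForwardDifference

/-! ### Derivatives of Bézier curves -/

theorem bern_eq_eval (N j : ℕ) (u : ℝ) : bern N j u = (bernsteinPolynomial ℝ N j).eval u := by
  simp [bern, bernsteinPolynomial]

theorem hasDerivAt_bern_zero (N : ℕ) (u : ℝ) :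
    HasDerivAt (bern N 0) (-(N : ℝ) * bern (N - 1) 0 u) u := by
  have h := (bernsteinPolynomial ℝ N 0).hasDerivAt u
  rw [bernsteinPolynomial.derivative_zero] at h
  have e : bern N 0 = fun u => (bernsteinPolynomial ℝ N 0).eval u := funext (bern_eq_eval N 0)
  rw [e, bern_eq_eval]
  simpa using h

theorem hasDerivAt_bern_succ (N j : ℕ) (u : ℝ) :
    HasDerivAt (bern N (j + 1)) ((N : ℝ) * (bern (N - 1) j u - bern (N - 1) (j + 1) u)) u := by
  have h := (bernsteinPolynomial ℝ N (j + 1)).hasDerivAt u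
  rw [bernsteinPolynomial.derivative_succ] at h
  have e : bern N (j + 1) = fun u => (bernsteinPolynomial ℝ N (j + 1)).eval u :=
    funext (bern_eq_eval N (j + 1))
  rw [e, bern_eq_eval, bern_eq_eval]
  simpa using h

section Curves

variable {d : ℕ}

theorem curve_congr (N : ℕ) (w w' : ℕ → EuclideanSpace ℝ (Fin d)) (h : ∀ j ≤ N, w j = w' j) :
    curve N w = curve N w' := by
  ext1 u
  refine Finset.sum_congr rfl fun j hj => ?_
  rw [h j (by simpa [Nat.lt_succ_iff] using hj)]

theorem curve_zero (N : ℕ) (w : ℕ → EuclideanSpace ℝ (Fin d)) : curve N w 0 = w 0 := by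
  rw [curve, Finset.sum_eq_single 0]
  · simp [bern]
  · intro j _ hj
    simp [bern, hj]
  · simp

theorem curve_one (N : ℕ) (w : ℕ → EuclideanSpace ℝ (Fin d)) : curve N w 1 = w N := by
  rw [curve, Finset.sum_eq_single N]
  · simp [bern]
  · intro j hj hj'
    have : N - j ≠ 0 := by simp at hj; omega
    simp [bern, this]
  · simp

theorem contDiff_curve (N : ℕ) (w : ℕ → EuclideanSpace ℝ (Fin d)) (n : WithTop ℕ∞) :
    ContDiff ℝ n (curve N w) := by
  unfold curve bern
  fun_prop

theorem hasDerivAt_curve (N : ℕ) (w : ℕ → EuclideanSpace ℝ (Fin d)) (u : ℝ) :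
    HasDerivAt (curve N w) ((N : ℝ) • curve (N - 1) (fwdDiff 1 w) u) u := by
  cases N with
  | zero =>
    have : curve 0 w = fun _ => w 0 := by ext1 u; simp [curve, bern]
    rw [this]
    simpa using hasDerivAt_const u (w 0)
  | succ N =>
    have h : HasDerivAt (fun u => ∑ j ∈ Finset.range (N + 1), bern (N + 1) (j + 1) u • w (j + 1)
        + bern (N + 1) 0 u • w 0)
        (∑ j ∈ Finset.range (N + 1),
          (((N + 1 : ℕ) : ℝ) * (bern N j u - bern N (j + 1) u)) • w (j + 1)
        + (-((N + 1 : ℕ) : ℝ) * bern N 0 u) • w 0) u := by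
      refine HasDerivAt.add ?_ ((hasDerivAt_bern_zero (N + 1) u).smul_const (w 0))
      exact HasDerivAt.fun_sum fun j _ => (hasDerivAt_bern_succ (N + 1) j u).smul_const (w (j + 1))
    have e : curve (N + 1) w = fun u => ∑ j ∈ Finset.range (N + 1),
        bern (N + 1) (j + 1) u • w (j + 1) + bern (N + 1) 0 u • w 0 := by
      ext1 u
      rw [curve, Finset.sum_range_succ']
    rw [e]
    convert! h using 1
    -- `N.choose (N + 1) = 0` removes the extra top term in the summation by parts.
    have hz : bern N (N + 1) u = 0 := by simp [bern]
    have s1 : ∑ j ∈ Finset.range (N + 1), bern N (j + 1) u • w (j + 1) + bern N 0 u • w 0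
        = ∑ j ∈ Finset.range (N + 1), bern N j u • w j := by
      rw [← Finset.sum_range_succ' (fun j => bern N j u • w j), Finset.sum_range_succ, hz,
        zero_smul,
        add_zero]
    simp only [curve, fwdDiff, Nat.add_sub_cancel, smul_sub, Finset.sum_sub_distrib, mul_sub,
      sub_smul,
      mul_smul, neg_smul, neg_mul, ← Finset.smul_sum]
    rw [← s1, smul_add]
    abel

theorem iteratedDeriv_curve (N : ℕ) (w : ℕ → EuclideanSpace ℝ (Fin d)) (j : ℕ) :
    iteratedDeriv j (curve N w)
      = fun u => (N.descFactorial j : ℝ) • curve (N - j) ((fwdDiff (1 : ℕ))^[j] w) u := by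
  induction j with
  | zero => simp
  | succ j ih =>
    ext1 u
    rw [iteratedDeriv_succ, ih]
    have := ((hasDerivAt_curve (N - j) ((fwdDiff (1 : ℕ))^[j] w) u).const_smul
      (N.descFactorial j : ℝ)).deriv
    refine Eq.trans this ?_
    rw [smul_smul, Nat.descFactorial_succ, Function.iterate_succ_apply', Nat.sub_sub]
    push_cast
    rw [mul_comm]

/-- The Bézier curve over the interval `[a, a + h]`. -/
def segment (N : ℕ) (w : ℕ → EuclideanSpace ℝ (Fin d)) (a h : ℝ) (x : ℝ) :
    EuclideanSpace ℝ (Fin d) := curve N w ((x - a) / h)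

theorem contDiff_segment (N : ℕ) (w : ℕ → EuclideanSpace ℝ (Fin d)) (a h : ℝ)
    (n : WithTop ℕ∞) : ContDiff ℝ n (segment N w a h) := by
  have := contDiff_curve N w n
  unfold segment
  exact this.comp (by fun_prop)

theorem iteratedDeriv_segment (N : ℕ) (w : ℕ → EuclideanSpace ℝ (Fin d)) (a h : ℝ) (j : ℕ)
    (x : ℝ) : iteratedDeriv j (segment N w a h) x = (h⁻¹ ^ j * (N.descFactorial j : ℝ)) •
      curve (N - j) ((fwdDiff (1 : ℕ))^[j] w) ((x - a) / h) := by
  have e : segment N w a h = fun x => (fun y => curve N w (h⁻¹ * y)) (x - a) := by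
    ext1 x
    rw [segment, div_eq_inv_mul]
  have h1 := congrFun (iteratedDeriv_comp_sub_const (n := j)
    (f := fun y => curve N w (h⁻¹ * y)) (s := a)) x
  rw [e]
  refine Eq.trans h1 ?_
  rw [iteratedDeriv_comp_const_smul (contDiff_curve N w j),
    iteratedDeriv_curve]
  simp only [smul_smul, div_eq_inv_mul]

/-- Only the germ of `F` on the right of `a` matters, and there `F` is a smooth curve whose
derivative within the half-line is its ordinary derivative. For `j > N` the factor `N.descFactorial
j` is zero. -/
theorem rightDeriv_of_eq_segment (N : ℕ) (w : ℕ → EuclideanSpace ℝ (Fin d)) (a b : ℝ)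
    (hab : a < b) (F : ℝ → EuclideanSpace ℝ (Fin d))
    (hF : ∀ x ∈ Set.Ico a b, F x = segment N w a (b - a) x) (j : ℕ) :
    rightDeriv j F a = ((b - a)⁻¹ ^ j * (N.descFactorial j : ℝ)) • (fwdDiff (1 : ℕ))^[j] w 0 := by
  have h1 : F =ᶠ[nhdsWithin a (Set.Ici a)] segment N w a (b - a) := by
    filter_upwards [Ico_mem_nhdsGE hab] with x hx using hF x hx
  have h2 : rightDeriv j F a = rightDeriv j (segment N w a (b - a)) a := by
    rw [rightDeriv, rightDeriv, iteratedDerivWithin, iteratedDerivWithin,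
      h1.iteratedFDerivWithin_eq (hF a ⟨le_rfl, hab⟩)]
  rw [h2, rightDeriv, iteratedDerivWithin_eq_iteratedDeriv (uniqueDiffOn_Ici a)
    (contDiff_segment N w a (b - a) j).contDiffAt (Set.self_mem_Ici), iteratedDeriv_segment,
    sub_self, zero_div, curve_zero]

theorem leftDeriv_of_eq_segment (N : ℕ) (w : ℕ → EuclideanSpace ℝ (Fin d)) (a b : ℝ)
    (hab : a < b) (F : ℝ → EuclideanSpace ℝ (Fin d))
    (hF : ∀ x ∈ Set.Ioc a b, F x = segment N w a (b - a) x) (j : ℕ) :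
    leftDeriv j F b
      = ((b - a)⁻¹ ^ j * (N.descFactorial j : ℝ)) • (fwdDiff (1 : ℕ))^[j] w (N - j) := by
  have h1 : F =ᶠ[nhdsWithin b (Set.Iic b)] segment N w a (b - a) := by
    filter_upwards [Ioc_mem_nhdsLE hab] with x hx using hF x hx
  have h2 : leftDeriv j F b = leftDeriv j (segment N w a (b - a)) b := by
    rw [leftDeriv, leftDeriv, iteratedDerivWithin, iteratedDerivWithin,
      h1.iteratedFDerivWithin_eq (hF b ⟨hab, le_rfl⟩)]
  rw [h2, leftDeriv, iteratedDerivWithin_eq_iteratedDeriv (uniqueDiffOn_Iic b)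
    (contDiff_segment N w a (b - a) j).contDiffAt (Set.self_mem_Iic), iteratedDeriv_segment,
    div_self (sub_pos.2 hab).ne', curve_one]

/-! ### The error of one segment -/

theorem curve_apply (N : ℕ) (w : ℕ → EuclideanSpace ℝ (Fin d)) (u : ℝ) (c : Fin d) :
    curve N w u c = ∑ j ∈ Finset.range (N + 1), bern N j u * w j c := by
  simp [curve]

theorem integral_norm_curve_sub_curve_sq (n m : ℕ) (p q : ℕ → EuclideanSpace ℝ (Fin d)) :
    ∫ u in (0 : ℝ)..1, ‖curve n p u - curve m q u‖ ^ 2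
      = ∑ c : Fin d, (iForm n n (fun j => p j c) (fun j => p j c)
          + iForm m m (fun j => q j c) (fun j => q j c)
          - 2 * iForm n m (fun j => p j c) (fun j => q j c)) := by
  have hc := continuous_bern
  simp only [EuclideanSpace.real_norm_sq_eq, PiLp.sub_apply, curve_apply]
  rw [intervalIntegral.integral_finsetSum]
  · refine Finset.sum_congr rfl fun c _ => ?_
    rw [← integral_sum_mul_sum, ← integral_sum_mul_sum, ← integral_sum_mul_sum,
      ← intervalIntegral.integral_const_mul, ← intervalIntegral.integral_add,
      ← intervalIntegral.integral_sub]
    · congr 1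
      ext u
      ring
    all_goals exact Continuous.intervalIntegrable (by fun_prop) _ _
  · intro c _
    exact Continuous.intervalIntegrable (by fun_prop) _ _

/-- Endpoints form a null set, so agreement on the open interval suffices; this is why the values of
`P` at interior partition points play no role. Integrability is recorded for the later additivity
over segments. -/
theorem integral_norm_segment_sub_sq (n m : ℕ) (p q : ℕ → EuclideanSpace ℝ (Fin d)) (a b : ℝ)
    (hab : a < b) (P Q : ℝ → EuclideanSpace ℝ (Fin d))
    (hP : ∀ x ∈ Set.Ioo a b, P x = segment n p a (b - a) x)
    (hQ : ∀ x ∈ Set.Ioo a b, Q x = segment m q a (b - a) x) :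
    IntervalIntegrable (fun x => ‖P x - Q x‖ ^ 2) MeasureTheory.volume a b ∧
    ∫ x in a..b, ‖P x - Q x‖ ^ 2 = (b - a) *
      ∑ c : Fin d, (iForm n n (fun j => p j c) (fun j => p j c)
          + iForm m m (fun j => q j c) (fun j => q j c)
          - 2 * iForm n m (fun j => p j c) (fun j => q j c)) := by
  have hcont : Continuous fun x => ‖segment n p a (b - a) x - segment m q a (b - a) x‖ ^ 2 := by
    have := (contDiff_segment n p a (b - a) 0).continuous
    have := (contDiff_segment m q a (b - a) 0).continuous
    fun_prop
  have heq : Set.EqOn (fun x => ‖segment n p a (b - a) x - segment m q a (b - a) x‖ ^ 2)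
      (fun x => ‖P x - Q x‖ ^ 2) (Set.Ioo a b) := by
    intro x hx
    simp only [hP x hx, hQ x hx]
  constructor
  · refine (hcont.intervalIntegrable a b).congr_uIoo ?_
    rwa [Set.uIoo_of_le hab.le]
  · rw [← intervalIntegral.integral_congr_Ioo_of_le hab.le heq, ← integral_norm_curve_sub_curve_sq]
    have h0 : b - a ≠ 0 := (sub_pos.2 hab).ne'
    have := intervalIntegral.integral_comp_div_sub (a := a) (b := b)
      (fun u => ‖curve n p u - curve m q u‖ ^ 2) h0 (a / (b - a))
    simp only [← sub_div, sub_self, div_self h0, smul_eq_mul] at this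
    exact this

end Curves

/-! ### Forward differences of the prescribed control points -/

section Ends

variable {d : ℕ}

/-- The recursion is the expansion of the `j`-th difference solved for its top term, since
`(-1)^(j-h) = (-1)^(j+h)`. -/
theorem fwdDiff_startPoint (n m : ℕ) (p : ℕ → EuclideanSpace ℝ (Fin d)) (j : ℕ) :
    (fwdDiff (1 : ℕ))^[j] (startPoint n m p) 0
      = ((n.choose j : ℝ) * ((m.choose j : ℝ))⁻¹) • (fwdDiff (1 : ℕ))^[j] p 0 := by
  rw [fwdDiff_iter_zero_eq_sum, Finset.sum_range_succ, startPoint,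
    ← Finset.sum_range (fun h => ((-1 : ℝ) ^ (j + h) * (j.choose h : ℝ)) • startPoint n m p h)]
  have : ∀ h ∈ Finset.range j, ((-1 : ℝ) ^ (j - h) * (j.choose h : ℝ)) • startPoint n m p h
      = ((-1 : ℝ) ^ (j + h) * (j.choose h : ℝ)) • startPoint n m p h := by
    intro h hh
    obtain ⟨f, rfl⟩ := Nat.exists_eq_add_of_lt (Finset.mem_range.1 hh)
    congr 2
    rw [show h + f + 1 - h = f + 1 by omega, show h + f + 1 + h = f + 1 + 2 * h by ring,
      pow_add _ (f + 1), pow_mul]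
    simp
  rw [Finset.sum_congr rfl this]
  simp

theorem fwdDiff_endPoint (n m : ℕ) (p : ℕ → EuclideanSpace ℝ (Fin d)) (j : ℕ) :
    (fwdDiff (1 : ℕ))^[j] (endPoint n m p) 0
      = ((-1 : ℝ) ^ j * (n.choose j : ℝ) * ((m.choose j : ℝ))⁻¹) •
        (fwdDiff (1 : ℕ))^[j] p (n - j) := by
  have h1 : (fwdDiff (1 : ℕ))^[j] (endPoint n m p) 0
      = ∑ g ∈ Finset.range (j + 1), ((-1 : ℝ) ^ g * (j.choose g : ℝ)) • endPoint n m p (j - g) := by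
    rw [fwdDiff_iter_zero_eq_sum, ← Finset.sum_range_reflect]
    refine Finset.sum_congr rfl fun g hg => ?_
    have hg' : g ≤ j := by simpa [Nat.lt_succ_iff] using hg
    rw [show j + 1 - 1 - g = j - g by omega, Nat.sub_sub_self hg', Nat.choose_symm hg']
  rw [h1, Finset.sum_range_succ']
  have h2 := endPoint.eq_1 n m p j
  rw [← Finset.sum_range (fun g => ((-1 : ℝ) ^ (g + 1) * (j.choose (g + 1) : ℝ)) •
    endPoint n m p (j - (g + 1)))] at h2
  simp only [pow_zero, Nat.choose_zero_right, Nat.cast_one, mul_one, one_smul, tsub_zero]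
  rw [add_comm, ← eq_sub_iff_add_eq]
  exact h2

theorem shiftedFactorial_eq_descFactorial (m j : ℕ) (hj : j ≤ m) :
    shiftedFactorial ((m : ℝ) - j + 1) j = m.descFactorial j := by
  have h1 := factorial_mul_ascPochhammer_eval (m - j) j
  have h2 := Nat.factorial_mul_descFactorial hj
  rw [Nat.sub_add_cancel hj, ← h2, Nat.cast_sub hj] at h1
  rw [shiftedFactorial_eq_eval]
  push_cast at h1
  exact mul_left_cancel₀ (by exact_mod_cast Nat.factorial_ne_zero _) h1

theorem descFactorial_ne_zero (m j : ℕ) (hj : j ≤ m) : (m.descFactorial j : ℝ) ≠ 0 := by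
  rw [Nat.descFactorial_eq_factorial_mul_choose]
  exact_mod_cast mul_ne_zero (Nat.factorial_ne_zero j) (Nat.choose_pos hj).ne'

theorem sum_Icc_one_eq {M : Type*} [AddCommMonoid M] (f : ℕ → M) (h : ℕ) :
    ∑ j ∈ Finset.range (h + 1), f j = f 0 + ∑ j ∈ Finset.Icc 1 h, f j := by
  rw [Finset.range_eq_Ico, Finset.sum_eq_sum_Ico_succ_bot (Nat.succ_pos h)]
  congr 1

end Ends

namespace Data

variable {d s : ℕ} (D : Data d s)

theorem len_pos (ht : StrictMono D.t) (i : Fin (s + 1)) : 0 < D.len i :=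
  sub_pos.2 (ht Fin.castSucc_lt_succ)

theorem aCoeff_zero (i : Fin (s + 1)) : D.aCoeff i 0 = 1 := by
  simp [aCoeff, shiftedFactorial]

theorem inv_aCoeff (i : Fin (s + 1)) (j : ℕ) (hj : j ≤ D.m i) :
    (D.aCoeff i j)⁻¹ = (D.len i)⁻¹ ^ j * ((D.m i).descFactorial j : ℝ) := by
  rw [aCoeff, shiftedFactorial_eq_descFactorial _ _ hj, inv_div, inv_pow]
  ring

theorem aCoeff_ne_zero (ht : StrictMono D.t) (i : Fin (s + 1)) (j : ℕ) (hj : j ≤ D.m i) :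
    D.aCoeff i j ≠ 0 := by
  rw [aCoeff, shiftedFactorial_eq_descFactorial _ _ hj]
  exact div_ne_zero (pow_ne_zero _ (D.len_pos ht i).ne') (descFactorial_ne_zero _ _ hj)

theorem lam_zero (L : D.ParamIdx → ℝ) (i : Fin s) : D.lam L i 0 = D.kappa L i := by
  simp [lam, kappa]

/-- Reading `κ` as `λ` of order 0, the defining formula is a binomial transform, and differences at
0 invert it. -/
theorem fwdDiff_junctionRight (L : D.ParamIdx → ℝ) (i : Fin s) (j : ℕ) :
    (fwdDiff (1 : ℕ))^[j] (D.junctionRight L i) 0 = D.aCoeff i.succ j • D.lam L i j := by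
  apply fwdDiff_iter_zero_of_binomial (D.junctionRight L i) fun j => D.aCoeff i.succ j • D.lam L i j
  intro h
  simp only [sum_Icc_one_eq, junctionRight, aCoeff_zero, lam_zero, smul_smul]
  simp

theorem fwdDiff_junctionLeft (L : D.ParamIdx → ℝ) (i : Fin s) (j : ℕ) :
    (fwdDiff (1 : ℕ))^[j] (D.junctionLeft L i) 0
      = ((-1 : ℝ) ^ j * D.aCoeff i.castSucc j) • D.lam L i j := by
  apply fwdDiff_iter_zero_of_binomial (D.junctionLeft L i)
    fun j => ((-1 : ℝ) ^ j * D.aCoeff i.castSucc j) • D.lam L i j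
  intro h
  simp only [sum_Icc_one_eq, junctionLeft, aCoeff_zero, lam_zero, smul_smul]
  congr 1
  · simp
  · refine Finset.sum_congr rfl fun j _ => ?_
    congr 1
    ring

/-! ### The constraints in terms of the control points -/

/-- The constraints on the curve, expressed by forward differences of the control points. -/
def Compatible (q : Fin (s + 1) → ℕ → EuclideanSpace ℝ (Fin d)) : Prop :=
  (∀ j ≤ D.r 0, (fwdDiff (1 : ℕ))^[j] (q 0) 0
    = (((D.n 0).choose j : ℝ) * (((D.m 0).choose j : ℝ))⁻¹) • (fwdDiff (1 : ℕ))^[j] (D.p 0) 0) ∧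
  (∀ i : Fin s, ∀ j ≤ D.r i.succ.castSucc,
    (D.aCoeff i.castSucc j)⁻¹ • (fwdDiff (1 : ℕ))^[j] (q i.castSucc) (D.m i.castSucc - j)
      = (D.aCoeff i.succ j)⁻¹ • (fwdDiff (1 : ℕ))^[j] (q i.succ) 0) ∧
  (∀ j ≤ D.r (Fin.last (s + 1)),
    (fwdDiff (1 : ℕ))^[j] (q (Fin.last s)) (D.m (Fin.last s) - j)
      = (((D.n (Fin.last s)).choose j : ℝ) * (((D.m (Fin.last s)).choose j : ℝ))⁻¹) •
        (fwdDiff (1 : ℕ))^[j] (D.p (Fin.last s)) (D.n (Fin.last s) - j))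

/-- Compares `j`-th derivatives of curves of degrees `m` and `n` over the same interval: the
interval length and `j!` cancel in the quotient. -/
theorem smul_choose_iff {E : Type*} [AddCommGroup E] [Module ℝ E] (h : ℝ) (hh : h ≠ 0)
    (n m j : ℕ) (hj : j ≤ m) (x y : E) :
    (h⁻¹ ^ j * (m.descFactorial j : ℝ)) • x = (h⁻¹ ^ j * (n.descFactorial j : ℝ)) • y
      ↔ x = ((n.choose j : ℝ) * ((m.choose j : ℝ))⁻¹) • y := by
  have hc : (m.choose j : ℝ) ≠ 0 := by exact_mod_cast (Nat.choose_pos hj).ne'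
  have hf : (j ! : ℝ) ≠ 0 := by exact_mod_cast Nat.factorial_ne_zero j
  have hp : h⁻¹ ^ j ≠ 0 := pow_ne_zero _ (inv_ne_zero hh)
  have key : (h⁻¹ ^ j * (n.descFactorial j : ℝ)) • y
      = (h⁻¹ ^ j * (m.descFactorial j : ℝ)) • ((n.choose j : ℝ) * ((m.choose j : ℝ))⁻¹) • y := by
    rw [smul_smul, Nat.descFactorial_eq_factorial_mul_choose,
      Nat.descFactorial_eq_factorial_mul_choose]
    congr 1
    push_cast
    field_simp
  rw [key]
  exact smul_right_inj (mul_ne_zero hp (descFactorial_ne_zero m j hj))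

variable {D}

theorem isComposite_segment {q : Fin (s + 1) → ℕ → EuclideanSpace ℝ (Fin d)}
    {Q : ℝ → EuclideanSpace ℝ (Fin d)} (hQ : IsComposite D.t D.m q Q) (i : Fin (s + 1)) :
    ∀ x ∈ Set.Icc (D.t i.castSucc) (D.t i.succ),
      Q x = segment (D.m i) (q i) (D.t i.castSucc) (D.t i.succ - D.t i.castSucc) x :=
  hQ i

theorem rightDeriv_composite (ht : StrictMono D.t)
    {q : Fin (s + 1) → ℕ → EuclideanSpace ℝ (Fin d)}
    {Q : ℝ → EuclideanSpace ℝ (Fin d)} (hQ : IsComposite D.t D.m q Q) (i : Fin (s + 1)) (j : ℕ) :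
    rightDeriv j Q (D.t i.castSucc)
      = ((D.len i)⁻¹ ^ j * ((D.m i).descFactorial j : ℝ)) • (fwdDiff (1 : ℕ))^[j] (q i) 0 :=
  rightDeriv_of_eq_segment _ _ _ _ (ht Fin.castSucc_lt_succ) _
    (fun x hx => isComposite_segment hQ i x (Set.Ico_subset_Icc_self hx)) j

theorem leftDeriv_composite (ht : StrictMono D.t)
    {q : Fin (s + 1) → ℕ → EuclideanSpace ℝ (Fin d)}
    {Q : ℝ → EuclideanSpace ℝ (Fin d)} (hQ : IsComposite D.t D.m q Q) (i : Fin (s + 1)) (j : ℕ) :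
    leftDeriv j Q (D.t i.succ) = ((D.len i)⁻¹ ^ j * ((D.m i).descFactorial j : ℝ)) •
      (fwdDiff (1 : ℕ))^[j] (q i) (D.m i - j) :=
  leftDeriv_of_eq_segment _ _ _ _ (ht Fin.castSucc_lt_succ) _
    (fun x hx => isComposite_segment hQ i x (Set.Ioc_subset_Icc_self hx)) j

theorem rightDeriv_piecewise (ht : StrictMono D.t) {P : ℝ → EuclideanSpace ℝ (Fin d)}
    (hP : IsPiecewise D.t D.n D.p P) (j : ℕ) : rightDeriv j P (D.t 0)
      = ((D.len 0)⁻¹ ^ j * ((D.n 0).descFactorial j : ℝ)) • (fwdDiff (1 : ℕ))^[j] (D.p 0) 0 := by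
  refine rightDeriv_of_eq_segment _ _ _ _ (ht (Fin.castSucc_lt_succ (i := (0 : Fin (s + 1))))) _
    (fun x hx => ?_) j
  rcases eq_or_lt_of_le hx.1 with h | h
  · rw [← h, segment]
    simpa using hP.2.1
  · exact hP.1 0 x ⟨h, hx.2⟩

theorem leftDeriv_piecewise (ht : StrictMono D.t) {P : ℝ → EuclideanSpace ℝ (Fin d)}
    (hP : IsPiecewise D.t D.n D.p P) (j : ℕ) : leftDeriv j P (D.t (Fin.last (s + 1)))
      = ((D.len (Fin.last s))⁻¹ ^ j * ((D.n (Fin.last s)).descFactorial j : ℝ)) •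
        (fwdDiff (1 : ℕ))^[j] (D.p (Fin.last s)) (D.n (Fin.last s) - j) := by
  have hlt := ht (Fin.castSucc_lt_succ (i := Fin.last s))
  rw [← Fin.succ_last]
  refine leftDeriv_of_eq_segment _ _ _ _ hlt _ (fun x hx => ?_) j
  rcases eq_or_lt_of_le hx.2 with h | h
  · rw [h, segment, div_self (sub_pos.2 hlt).ne', Fin.succ_last]
    exact hP.2.2
  · exact hP.1 _ x ⟨hx.1, h⟩

theorem order_le (hr : ∀ i : Fin (s + 1), D.r i.castSucc + D.r i.succ + 1 < D.m i)
    (i : Fin s) : D.r i.succ.castSucc ≤ D.m i.castSucc ∧ D.r i.succ.castSucc ≤ D.m i.succ := by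
  have h1 := hr i.castSucc
  have h2 := hr i.succ
  rw [Fin.succ_castSucc] at h1
  omega

theorem isAdmissible_iff (ht : StrictMono D.t)
    (hr : ∀ i : Fin (s + 1), D.r i.castSucc + D.r i.succ + 1 < D.m i)
    {P : ℝ → EuclideanSpace ℝ (Fin d)} (hP : IsPiecewise D.t D.n D.p P)
    (q : Fin (s + 1) → ℕ → EuclideanSpace ℝ (Fin d)) (Q : ℝ → EuclideanSpace ℝ (Fin d)) :
    D.IsAdmissible P q Q ↔ IsComposite D.t D.m q Q ∧ D.Compatible q := by
  refine and_congr_right fun hQ => ?_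
  refine and_congr ?_ (and_congr ?_ ?_)
  · refine forall₂_congr fun j hj => ?_
    have h0 := hr 0
    rw [rightDeriv_piecewise ht hP, ← smul_choose_iff (D.len 0) (D.len_pos ht 0).ne' _ _ _
      (by simp only [Fin.castSucc_zero] at h0; omega), ← rightDeriv_composite ht hQ 0 j]
    rfl
  · refine forall_congr' fun i => forall₂_congr fun j hj => ?_
    have h1 := order_le hr i
    have e1 := leftDeriv_composite ht hQ i.castSucc j
    rw [Fin.succ_castSucc] at e1
    rw [e1, rightDeriv_composite ht hQ i.succ j, inv_aCoeff _ _ _ (by omega),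
      inv_aCoeff _ _ _ (by omega)]
  · refine forall₂_congr fun j hj => ?_
    have h0 : D.r (Fin.last s).castSucc + D.r (Fin.last (s + 1)) + 1 < D.m (Fin.last s) :=
      hr (Fin.last s)
    have e1 := leftDeriv_composite ht hQ (Fin.last s) j
    rw [Fin.succ_last] at e1
    rw [leftDeriv_piecewise ht hP, e1,
      smul_choose_iff (D.len (Fin.last s)) (D.len_pos ht _).ne' _ _ _ (by omega)]

theorem eq_of_mem_Ico (ht : StrictMono D.t) {x : ℝ} {i i' : Fin (s + 1)}
    (h : x ∈ Set.Ico (D.t i.castSucc) (D.t i.succ))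
    (h' : x ∈ Set.Ico (D.t i'.castSucc) (D.t i'.succ)) : i = i' := by
  have key : ∀ a b : Fin (s + 1), x ∈ Set.Ico (D.t a.castSucc) (D.t a.succ) →
      x ∈ Set.Ico (D.t b.castSucc) (D.t b.succ) → ¬ a < b := by
    intro a b ha hb hab
    have : a.succ ≤ b.castSucc := Fin.succ_le_castSucc_iff.2 hab
    exact absurd (ht.monotone this) (not_le.2 (hb.1.trans_lt ha.2))
  exact le_antisymm (not_lt.1 (key _ _ h' h)) (not_lt.1 (key _ _ h h'))

theorem exists_isComposite (ht : StrictMono D.t)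
    {q : Fin (s + 1) → ℕ → EuclideanSpace ℝ (Fin d)} (hq : D.Compatible q) :
    ∃ Q, IsComposite D.t D.m q Q := by
  classical
  -- Half-open intervals make the segment unique. In the parameter interval only the right endpoint
  -- reaches the default branch, whose value is the last control point, the end of the last segment.
  refine ⟨fun x => if h : ∃ i : Fin (s + 1), x ∈ Set.Ico (D.t i.castSucc) (D.t i.succ) then
    segment (D.m h.choose) (q h.choose) (D.t h.choose.castSucc)
      (D.t h.choose.succ - D.t h.choose.castSucc) x
    else q (Fin.last s) (D.m (Fin.last s)), ?_⟩
  have inner : ∀ (i : Fin (s + 1)) (x : ℝ), x ∈ Set.Ico (D.t i.castSucc) (D.t i.succ) →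
      (if h : ∃ i : Fin (s + 1), x ∈ Set.Ico (D.t i.castSucc) (D.t i.succ) then
        segment (D.m h.choose) (q h.choose) (D.t h.choose.castSucc)
          (D.t h.choose.succ - D.t h.choose.castSucc) x
        else q (Fin.last s) (D.m (Fin.last s)))
      = segment (D.m i) (q i) (D.t i.castSucc) (D.t i.succ - D.t i.castSucc) x := by
    intro i x hx
    have h : ∃ i : Fin (s + 1), x ∈ Set.Ico (D.t i.castSucc) (D.t i.succ) := ⟨i, hx⟩
    rw [dif_pos h, eq_of_mem_Ico ht h.choose_spec hx]
  intro i x hx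
  rcases eq_or_lt_of_le hx.2 with h | h
  · have hlt := ht (Fin.castSucc_lt_succ (i := i))
    rw [h, div_self (sub_pos.2 hlt).ne', curve_one]
    refine Fin.lastCases ?_ (fun i' => ?_) i
    · have : ¬ ∃ i : Fin (s + 1),
          D.t (Fin.last s).succ ∈ Set.Ico (D.t i.castSucc) (D.t i.succ) := by
        rintro ⟨b, hb⟩
        have := hb.2
        rw [ht.lt_iff_lt, Fin.succ_last] at this
        exact absurd this (not_lt.2 (Fin.le_last _))
      simp only [dif_neg this]
    -- At an interior partition point the definition uses the segment on the right; compatibility of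
    -- order 0 yields the value of the segment on the left.
    · have h1 := inner i'.succ (D.t i'.succ.castSucc) ⟨le_rfl, ht Fin.castSucc_lt_succ⟩
      have h2 := hq.2.1 i' 0 (Nat.zero_le _)
      rw [segment, sub_self, zero_div, curve_zero] at h1
      simp only [aCoeff_zero, inv_one, one_smul, Function.iterate_zero, id_eq, tsub_zero] at h2
      rw [Fin.succ_castSucc, h2]
      exact h1
  · exact inner i x ⟨hx.1, h⟩

/-! ### The squared error -/

theorem integral_eq_sum_segments (t : Fin (s + 2) → ℝ) (f : ℝ → ℝ)
    (hf : ∀ i : Fin (s + 1),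
      IntervalIntegrable f MeasureTheory.volume (t i.castSucc) (t i.succ)) :
    ∫ x in (t 0)..(t (Fin.last (s + 1))), f x
      = ∑ i : Fin (s + 1), ∫ x in (t i.castSucc)..(t i.succ), f x := by
  have hs : s + 1 < s + 2 := Nat.lt_succ_self _
  have h := intervalIntegral.sum_integral_adjacent_intervals (f := f)
    (μ := MeasureTheory.volume) (a := fun k => if h : k < s + 2 then t ⟨k, h⟩ else 0)
    (n := s + 1) (fun k hk => by
      have h1 : k < s + 2 := by omega
      have h2 : k + 1 < s + 2 := by omega
      simp only [dif_pos h1, dif_pos h2]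
      exact hf ⟨k, hk⟩)
  rw [Finset.sum_range] at h
  have h0 : 0 < s + 2 := by omega
  simp only [dif_pos h0, dif_pos hs] at h
  refine h.symm.trans (Finset.sum_congr rfl fun i _ => ?_)
  have h1 : (i : ℕ) < s + 2 := by omega
  have h2 : (i : ℕ) + 1 < s + 2 := by omega
  simp only [dif_pos h1, dif_pos h2]
  rfl

variable (D)

/-- The squared error on the `i`-th segment as a function of its control points. -/
def localError (i : Fin (s + 1)) (w : ℕ → EuclideanSpace ℝ (Fin d)) : ℝ :=
  D.len i * ∑ c : Fin d,
    (iForm (D.n i) (D.n i) (fun j => D.p i j c) (fun j => D.p i j c)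
      + iForm (D.m i) (D.m i) (fun j => w j c) (fun j => w j c)
      - 2 * iForm (D.n i) (D.m i) (fun j => D.p i j c) (fun j => w j c))

variable {D}

theorem sqError_eq (ht : StrictMono D.t) {P : ℝ → EuclideanSpace ℝ (Fin d)}
    (hP : IsPiecewise D.t D.n D.p P) {q : Fin (s + 1) → ℕ → EuclideanSpace ℝ (Fin d)}
    {Q : ℝ → EuclideanSpace ℝ (Fin d)} (hQ : IsComposite D.t D.m q Q) :
    D.sqError P Q = ∑ i, D.localError i (q i) := by
  have key : ∀ i : Fin (s + 1), _ := fun i =>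
    integral_norm_segment_sub_sq (D.n i) (D.m i) (D.p i) (q i) (D.t i.castSucc) (D.t i.succ)
      (ht Fin.castSucc_lt_succ) P Q (hP.1 i)
      (fun x hx => isComposite_segment hQ i x (Set.Ioo_subset_Icc_self hx))
  rw [sqError, integral_eq_sum_segments D.t _ fun i => (key i).1]
  exact Finset.sum_congr rfl fun i _ => (key i).2

end Data

/-! ### The inner control points are optimal -/

theorem gram_comm (m i j : ℕ) : gram m m i j = gram m m j i := by
  rw [gram, gram, add_comm i j]; ring

/-- A left inverse of a square matrix is also a right inverse; the normal equations need the Gram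
matrix on the left. -/
theorem gram_mul_cTable (k l N m g h : ℕ) (hm : m = N + k + l + 2)
    (hg : k + 1 ≤ g ∧ g ≤ m - l - 1) (hh : k + 1 ≤ h ∧ h ≤ m - l - 1) :
    ∑ j ∈ Finset.Icc (k + 1) (m - l - 1), gram m m g j * cTable m k l j h
      = if g = h then 1 else 0 := by
  let C : Matrix (Fin (N + 1)) (Fin (N + 1)) ℝ :=
    fun a b => cTable m k l (k + 1 + a) (k + 1 + b)
  let G : Matrix (Fin (N + 1)) (Fin (N + 1)) ℝ :=
    fun a b => gram m m (k + 1 + a) (k + 1 + b)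
  have hCG : C * G = 1 := by
    ext a b
    have := cTable_mul_gram k l N m (k + 1 + a) (k + 1 + b) hm (by omega) (by omega)
    rw [sum_inner_eq k l N m hm, Finset.sum_range] at this
    rw [Matrix.mul_apply, Matrix.one_apply]
    refine this.trans ?_
    congr 1
    exact propext ⟨fun h => Fin.ext (by omega), fun h => by rw [h]⟩
  have hGC' : G * C = 1 := mul_eq_one_comm.1 hCG
  have hGC := congrFun (congrFun hGC' (⟨g - k - 1, by omega⟩ : Fin (N + 1)))
    (⟨h - k - 1, by omega⟩ : Fin (N + 1))
  rw [Matrix.mul_apply, Matrix.one_apply] at hGC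
  rw [sum_inner_eq k l N m hm, Finset.sum_range]
  simp only [C, G] at hGC
  rw [show k + 1 + (g - k - 1) = g by omega, show k + 1 + (h - k - 1) = h by omega] at hGC
  rw [hGC]
  congr 1
  simp only [Fin.mk.injEq]
  exact propext (by omega)

section Inner

variable {d : ℕ}

theorem vPoint_apply (n m : ℕ) (p : ℕ → EuclideanSpace ℝ (Fin d)) (h : ℕ) (c : Fin d) :
    vPoint n m p h c = ∑ i ∈ Finset.range (n + 1), gram n m i h * p i c := by
  simp only [vPoint, gram, PiLp.smul_apply, WithLp.ofLp_sum, Finset.sum_apply, smul_eq_mul,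
    Finset.mul_sum]
  refine Finset.sum_congr rfl fun i _ => ?_
  ring

theorem sum_range_split {M : Type*} [AddCommMonoid M] (k l m : ℕ) (hm : k + l + 1 < m)
    (f : ℕ → M) : ∑ j ∈ Finset.range (m + 1), f j
      = ∑ j ∈ Finset.Icc 0 k, f j + ∑ j ∈ Finset.Icc (k + 1) (m - l - 1), f j
        + ∑ j ∈ Finset.Icc (m - l) m, f j := by
  have e1 : Finset.Icc 0 k = Finset.Ico 0 (k + 1) := by
    ext x; simp only [Finset.mem_Icc, Finset.mem_Ico]; omega
  have e2 : Finset.Icc (k + 1) (m - l - 1) = Finset.Ico (k + 1) (m - l) := by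
    ext x; simp only [Finset.mem_Icc, Finset.mem_Ico]; omega
  have e3 : Finset.Icc (m - l) m = Finset.Ico (m - l) (m + 1) := by
    ext x; simp only [Finset.mem_Icc, Finset.mem_Ico]; omega
  rw [e1, e2, e3, Finset.sum_Ico_consecutive _ (by omega) (by omega),
    Finset.sum_Ico_consecutive _ (by omega) (by omega), Finset.range_eq_Ico]

/-- These are the normal equations of the inner least squares problem. Applying the Gram matrix to
`innerPoint`, the `C` part collapses to `v_g`, and the `K` part cancels the contribution of the
boundary control points. -/
theorem sum_gram_mul_eq_of_innerPoint (n m k l : ℕ) (hm : k + l + 1 < m)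
    (p w : ℕ → EuclideanSpace ℝ (Fin d))
    (hw : ∀ j ∈ Finset.Icc (k + 1) (m - l - 1), w j = innerPoint n m k l p w j) (c : Fin d)
    (g : ℕ) (hg : k + 1 ≤ g ∧ g ≤ m - l - 1) :
    ∑ j ∈ Finset.range (m + 1), gram m m j g * w j c
      = ∑ i ∈ Finset.range (n + 1), gram n m i g * p i c := by
  obtain ⟨N, hN⟩ : ∃ N, m = N + k + l + 2 := ⟨m - k - l - 2, by omega⟩
  rw [← vPoint_apply n m p, sum_range_split k l m hm]
  have hK : ∀ h, h ≤ m → (h ≤ k ∨ m - l ≤ h) →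
      ∑ j ∈ Finset.Icc (k + 1) (m - l - 1), gram m m j g * kCoeff m k l j h = gram m m h g := by
    intro h hh hout
    have := sum_kCoeff_mul_gram k l N m (g - k - 1) h hN (by omega) hh hout
    rw [show k + 1 + (g - k - 1) = g by omega] at this
    rw [sum_inner_eq k l N m hN, ← this]
    exact Finset.sum_congr rfl fun e _ => mul_comm _ _
  have e1 : ∑ j ∈ Finset.Icc (k + 1) (m - l - 1), gram m m j g * w j c
      = vPoint n m p g c - (∑ h ∈ Finset.Icc 0 k, gram m m h g * w h c
        + ∑ h ∈ Finset.Icc (m - l) m, gram m m h g * w h c) := by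
    have e2 : ∀ j ∈ Finset.Icc (k + 1) (m - l - 1), gram m m j g * w j c
        = ∑ h ∈ Finset.Icc (k + 1) (m - l - 1), gram m m g j * cTable m k l j h * vPoint n m p h c
          - (∑ h ∈ Finset.Icc 0 k, gram m m j g * kCoeff m k l j h * w h c
            + ∑ h ∈ Finset.Icc (m - l) m, gram m m j g * kCoeff m k l j h * w h c) := by
      intro j hj
      rw [hw j hj, innerPoint, gram_comm m g j]
      simp only [PiLp.sub_apply, PiLp.add_apply, PiLp.smul_apply, WithLp.ofLp_sum,
        Finset.sum_apply, smul_eq_mul, mul_sub, mul_add, Finset.mul_sum, mul_assoc]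
    rw [Finset.sum_congr rfl e2, Finset.sum_sub_distrib, Finset.sum_add_distrib,
      Finset.sum_comm, Finset.sum_comm (t := Finset.Icc 0 k),
      Finset.sum_comm (t := Finset.Icc (m - l) m)]
    simp only [← Finset.sum_mul]
    congr 1
    · rw [Finset.sum_eq_single g]
      · rw [gram_mul_cTable k l N m g g hN hg hg, if_pos rfl, one_mul]
      · intro h hh hne
        rw [Finset.mem_Icc] at hh
        rw [gram_mul_cTable k l N m g h hN hg hh, if_neg hne.symm, zero_mul]
      · intro h
        exact absurd (Finset.mem_Icc.2 hg) h
    · congr 1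
      · refine Finset.sum_congr rfl fun h hh => ?_
        rw [Finset.mem_Icc] at hh
        rw [hK h (by omega) (by omega)]
      · refine Finset.sum_congr rfl fun h hh => ?_
        rw [Finset.mem_Icc] at hh
        rw [hK h (by omega) (by omega)]
  rw [e1]
  ring

/-- Orthogonality of the residual to every polynomial in the inner span: only inner indices of `y`
contribute, and for those the normal equations hold. -/
theorem iForm_eq_of_innerPoint (n m k l : ℕ) (hm : k + l + 1 < m)
    (p w : ℕ → EuclideanSpace ℝ (Fin d))
    (hw : ∀ j ∈ Finset.Icc (k + 1) (m - l - 1), w j = innerPoint n m k l p w j) (c : Fin d)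
    (y : ℕ → ℝ) (hy : ∀ j, j ≤ k → y j = 0) (hy' : ∀ j ≤ m, m - l ≤ j → y j = 0) :
    iForm m m (fun j => w j c) y = iForm n m (fun j => p j c) y := by
  rw [iForm_eq_sum_gram, iForm_eq_sum_gram, Finset.sum_comm,
    Finset.sum_comm (s := Finset.range (n + 1))]
  refine Finset.sum_congr rfl fun g hg => ?_
  rw [← Finset.sum_mul, ← Finset.sum_mul]
  by_cases h : k + 1 ≤ g ∧ g ≤ m - l - 1
  · rw [sum_gram_mul_eq_of_innerPoint n m k l hm p w hw c g h]
  · have : y g = 0 := by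
      simp at hg
      by_cases h' : g ≤ k
      · exact hy g h'
      · exact hy' g (by omega) (by omega)
    rw [this, mul_zero, mul_zero]

theorem innerPoint_congr (n m k l : ℕ) (p w w' : ℕ → EuclideanSpace ℝ (Fin d))
    (h1 : ∀ j ≤ k, w j = w' j) (h2 : ∀ j ≤ m, m - l ≤ j → w j = w' j) (j : ℕ) :
    innerPoint n m k l p w j = innerPoint n m k l p w' j := by
  rw [innerPoint, innerPoint]
  congr 2
  · refine Finset.sum_congr rfl fun h hh => ?_
    rw [h1 h (Finset.mem_Icc.1 hh).2]
  · refine Finset.sum_congr rfl fun h hh => ?_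
    rw [h2 h (Finset.mem_Icc.1 hh).2 (Finset.mem_Icc.1 hh).1]

theorem vPoint_zero (n m h : ℕ) :
    vPoint n m (fun _ => (0 : EuclideanSpace ℝ (Fin d))) h = 0 := by
  simp [vPoint]

theorem innerPoint_add_smul (n m k l : ℕ) (p w v : ℕ → EuclideanSpace ℝ (Fin d)) (a : ℝ) (j : ℕ) :
    innerPoint n m k l p (fun h => w h + a • v h) j
      = innerPoint n m k l p w j + a • innerPoint n m k l (fun _ => 0) v j := by
  simp only [innerPoint, vPoint_zero, smul_zero, Finset.sum_const_zero, zero_sub, smul_add,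
    Finset.sum_add_distrib, smul_neg, Finset.smul_sum, smul_comm a]
  abel

theorem fwdDiff_iter_zero_fun (j x : ℕ) :
    (fwdDiff (1 : ℕ))^[j] (fun _ => (0 : EuclideanSpace ℝ (Fin d))) x = 0 := by
  rw [fwdDiff_iter_eq_sum_shift]; simp

theorem startPoint_zero (n m j : ℕ) :
    startPoint n m (fun _ => (0 : EuclideanSpace ℝ (Fin d))) j = 0 := by
  rw [eq_sum_fwdDiff_iter_zero (startPoint n m _) j]
  simp [fwdDiff_startPoint, fwdDiff_iter_zero_fun]

theorem endPoint_zero (n m j : ℕ) :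
    endPoint n m (fun _ => (0 : EuclideanSpace ℝ (Fin d))) j = 0 := by
  rw [eq_sum_fwdDiff_iter_zero (endPoint n m _) j]
  simp [fwdDiff_endPoint, fwdDiff_iter_zero_fun]

end Inner

namespace Data

variable {d s : ℕ} (D : Data d s)

/-! ### Boundary control points and parameters -/

/-- The boundary control points of `q` are those prescribed by the parameters `L`. -/
def HasBoundary (L : D.ParamIdx → ℝ) (q : Fin (s + 1) → ℕ → EuclideanSpace ℝ (Fin d)) : Prop :=
  (∀ i, ∀ j ≤ D.r i.castSucc, q i j = D.headPoint L i j) ∧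
  (∀ i, ∀ h ≤ D.r i.succ, q i (D.m i - h) = D.tailPoint L i h)

theorem headPoint_zero (L : D.ParamIdx → ℝ) :
    D.headPoint L 0 = startPoint (D.n 0) (D.m 0) (D.p 0) := rfl

theorem headPoint_succ (L : D.ParamIdx → ℝ) (i : Fin s) :
    D.headPoint L i.succ = D.junctionRight L i := rfl

theorem tailPoint_last (L : D.ParamIdx → ℝ) : D.tailPoint L (Fin.last s)
    = endPoint (D.n (Fin.last s)) (D.m (Fin.last s)) (D.p (Fin.last s)) := by
  simp [tailPoint]

theorem tailPoint_castSucc (L : D.ParamIdx → ℝ) (i : Fin s) :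
    D.tailPoint L i.castSucc = D.junctionLeft L i := by
  simp [tailPoint]

variable {D}

theorem smul_fwdDiff_tail (w X : ℕ → EuclideanSpace ℝ (Fin d)) (m r j : ℕ) (hr : r ≤ m)
    (hj : j ≤ r) (h : ∀ h ≤ r, w (m - h) = X h) :
    (-1 : ℝ) ^ j • (fwdDiff (1 : ℕ))^[j] w (m - j) = (fwdDiff (1 : ℕ))^[j] X 0 := by
  rw [← fwdDiff_iter_reverse w m j (by omega)]
  exact (fwdDiff_iter_zero_congr_iff (fun h => w (m - h)) X r).2 h j hj

theorem compatible_iff_exists_hasBoundary (ht : StrictMono D.t)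
    (hr : ∀ i : Fin (s + 1), D.r i.castSucc + D.r i.succ + 1 < D.m i)
    (q : Fin (s + 1) → ℕ → EuclideanSpace ℝ (Fin d)) :
    D.Compatible q ↔ ∃ L, D.HasBoundary L q := by
  have h0 : D.r 0 + D.r (Fin.succ 0) + 1 < D.m 0 := hr 0
  have hl : D.r (Fin.last s).castSucc + D.r (Fin.last (s + 1)) + 1 < D.m (Fin.last s) :=
    hr (Fin.last s)
  have hsq : ∀ j : ℕ, (-1 : ℝ) ^ j * (-1 : ℝ) ^ j = 1 := fun j => by rw [← mul_pow]; simp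
  have hinj : ∀ (j : ℕ) (x y : EuclideanSpace ℝ (Fin d)), (-1 : ℝ) ^ j • x = y →
      x = (-1 : ℝ) ^ j • y := by
    rintro j x y rfl
    rw [smul_smul, hsq, one_smul]
  constructor
  · rintro ⟨hs, hj, he⟩
    -- By `inv_aCoeff` this is the `j`-th derivative at the partition point, taken from the segment
    -- on its right; compatibility makes it serve the segment on the left too.
    let L : D.ParamIdx → ℝ := fun ξ => ((D.aCoeff ξ.1.1.succ ξ.1.2)⁻¹ •
      (fwdDiff (1 : ℕ))^[(ξ.1.2 : ℕ)] (q ξ.1.1.succ) 0) ξ.2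
    have hlam : ∀ i : Fin s, ∀ j ≤ D.r i.succ.castSucc, D.lam L i j
        = (D.aCoeff i.succ j)⁻¹ • (fwdDiff (1 : ℕ))^[j] (q i.succ) 0 := by
      intro i j hj
      rw [lam, dif_pos (Nat.lt_succ_of_le hj)]
    refine ⟨L, fun i => ?_, fun i => ?_⟩
    · refine Fin.cases ?_ (fun i' => ?_) i
      · refine (fwdDiff_iter_zero_congr_iff _ _ _).1 fun j hj => ?_
        rw [headPoint_zero, fwdDiff_startPoint]
        exact hs j hj
      · refine (fwdDiff_iter_zero_congr_iff _ _ _).1 fun j hj => ?_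
        have := order_le hr i'
        rw [headPoint_succ, fwdDiff_junctionRight, hlam i' j hj, smul_smul,
          mul_inv_cancel₀ (aCoeff_ne_zero D ht _ _ (by omega)), one_smul]
    · refine Fin.lastCases ?_ (fun i' => ?_) i
      · refine (fwdDiff_iter_zero_congr_iff
          (fun h => q (Fin.last s) (D.m (Fin.last s) - h)) _ _).1 fun j hj => ?_
        replace hj : j ≤ D.r (Fin.last (s + 1)) := hj
        rw [fwdDiff_iter_reverse _ _ _ (by omega), tailPoint_last, fwdDiff_endPoint, he j hj,
          smul_smul, mul_assoc]
      · have := order_le hr i'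
        refine (fwdDiff_iter_zero_congr_iff
          (fun h => q i'.castSucc (D.m i'.castSucc - h)) _ _).1 fun j hj' => ?_
        rw [Fin.succ_castSucc] at hj'
        rw [fwdDiff_iter_reverse _ _ _ (by omega), tailPoint_castSucc, fwdDiff_junctionLeft,
          hlam i' j hj', ← hj i' j hj', smul_smul, mul_assoc,
          mul_inv_cancel₀ (aCoeff_ne_zero D ht _ _ (by omega)), mul_one]
  · rintro ⟨L, hh, htl⟩
    refine ⟨fun j hj => ?_, fun i j hj => ?_, fun j hj => ?_⟩
    · rw [(fwdDiff_iter_zero_congr_iff _ _ _).2 (hh 0) j hj, headPoint_zero, fwdDiff_startPoint]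
    · have := order_le hr i
      have h1 := htl i.castSucc
      rw [Fin.succ_castSucc] at h1
      have h2 := hinj _ _ _ (smul_fwdDiff_tail _ _ _ _ j (by omega) hj h1)
      rw [h2, tailPoint_castSucc, fwdDiff_junctionLeft,
        (fwdDiff_iter_zero_congr_iff _ _ _).2 (hh i.succ) j hj, headPoint_succ,
        fwdDiff_junctionRight, smul_smul, smul_smul, smul_smul, mul_assoc,
        ← mul_assoc ((-1 : ℝ) ^ j),
        hsq, one_mul, inv_mul_cancel₀ (aCoeff_ne_zero D ht _ _ (by omega)),
        inv_mul_cancel₀ (aCoeff_ne_zero D ht _ _ (by omega))]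
    · have h1 := htl (Fin.last s)
      rw [Fin.succ_last] at h1
      have h2 := hinj _ _ _ (smul_fwdDiff_tail _ _ _ _ j (by omega) hj h1)
      rw [h2, tailPoint_last, fwdDiff_endPoint, smul_smul, ← mul_assoc, ← mul_assoc, hsq, one_mul]

theorem controlPoint_of_le (L : D.ParamIdx → ℝ) (i : Fin (s + 1)) (j : ℕ)
    (hj : j ≤ D.r i.castSucc) : D.controlPoint L i j = D.headPoint L i j := by
  rw [controlPoint, if_neg (by omega), boundaryPoint, if_pos hj]

theorem controlPoint_of_ge (hr : ∀ i : Fin (s + 1), D.r i.castSucc + D.r i.succ + 1 < D.m i)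
    (L : D.ParamIdx → ℝ) (i : Fin (s + 1)) (h : ℕ)
    (hh : h ≤ D.r i.succ) : D.controlPoint L i (D.m i - h) = D.tailPoint L i h := by
  have := hr i
  rw [controlPoint, if_neg (by omega), boundaryPoint, if_neg (by omega), if_pos (by omega),
    Nat.sub_sub_self (by omega)]

theorem hasBoundary_controlPoint
    (hr : ∀ i : Fin (s + 1), D.r i.castSucc + D.r i.succ + 1 < D.m i) (L : D.ParamIdx → ℝ) :
    D.HasBoundary L (D.controlPoint L) :=
  ⟨fun i j hj => controlPoint_of_le L i j hj, fun i h hh => controlPoint_of_ge hr L i h hh⟩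

/-- `innerPoint` reads only boundary indices, where `controlPoint` and `boundaryPoint` agree. The
result is the self-referential form required by `iForm_eq_of_innerPoint`. -/
theorem controlPoint_inner (hr : ∀ i : Fin (s + 1), D.r i.castSucc + D.r i.succ + 1 < D.m i)
    (L : D.ParamIdx → ℝ) (i : Fin (s + 1)) (j : ℕ)
    (hj : j ∈ Finset.Icc (D.r i.castSucc + 1) (D.m i - D.r i.succ - 1)) :
    D.controlPoint L i j = innerPoint (D.n i) (D.m i) (D.r i.castSucc) (D.r i.succ) (D.p i)
      (D.controlPoint L i) j := by
  have := hr i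
  rw [Finset.mem_Icc] at hj
  conv_lhs => rw [controlPoint, if_pos (by omega)]
  apply innerPoint_congr
  · intro h hh
    rw [controlPoint, if_neg (by omega)]
  · intro h _ hh
    rw [controlPoint, if_neg (by omega)]

variable (D)

/-! ### The linear part of the control points -/

/-- The same data with the zero curve as the given curve. -/
abbrev homogeneous : Data d s := ⟨D.t, D.n, D.m, D.r, fun _ _ => 0⟩

theorem lam_add_smul (L M : D.ParamIdx → ℝ) (a : ℝ) (i : Fin s) (j : ℕ) :
    D.lam (L + a • M) i j = D.lam L i j + a • D.homogeneous.lam M i j := by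
  by_cases hj : j < D.r i.succ.castSucc + 1
  · simp only [lam, dif_pos hj]
    ext c
    simp
  · simp only [lam, dif_neg hj]
    simp

theorem kappa_add_smul (L M : D.ParamIdx → ℝ) (a : ℝ) (i : Fin s) :
    D.kappa (L + a • M) i = D.kappa L i + a • D.homogeneous.kappa M i := by
  ext c
  simp [kappa]

theorem headPoint_add_smul (L M : D.ParamIdx → ℝ) (a : ℝ) (i : Fin (s + 1)) (h : ℕ) :
    D.headPoint (L + a • M) i h = D.headPoint L i h + a • D.homogeneous.headPoint M i h := by
  refine Fin.cases ?_ (fun i' => ?_) i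
  · rw [headPoint_zero, headPoint_zero, headPoint_zero, startPoint_zero, smul_zero, add_zero]
  · have : ∀ j, D.homogeneous.aCoeff i'.succ j = D.aCoeff i'.succ j := fun _ => rfl
    simp only [headPoint_succ, junctionRight, kappa_add_smul, lam_add_smul, smul_add,
      Finset.sum_add_distrib, Finset.smul_sum, this, smul_comm a]
    abel

theorem tailPoint_add_smul (L M : D.ParamIdx → ℝ) (a : ℝ) (i : Fin (s + 1)) (h : ℕ) :
    D.tailPoint (L + a • M) i h = D.tailPoint L i h + a • D.homogeneous.tailPoint M i h := by
  refine Fin.lastCases ?_ (fun i' => ?_) i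
  · rw [tailPoint_last, tailPoint_last, tailPoint_last, endPoint_zero, smul_zero, add_zero]
  · have : ∀ j, D.homogeneous.aCoeff i'.castSucc j = D.aCoeff i'.castSucc j := fun _ => rfl
    simp only [tailPoint_castSucc, junctionLeft, kappa_add_smul, lam_add_smul, smul_add,
      Finset.sum_add_distrib, Finset.smul_sum, this, smul_comm a]
    abel

theorem boundaryPoint_add_smul (L M : D.ParamIdx → ℝ) (a : ℝ) (i : Fin (s + 1)) (j : ℕ) :
    D.boundaryPoint (L + a • M) i j
      = D.boundaryPoint L i j + a • D.homogeneous.boundaryPoint M i j := by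
  simp only [boundaryPoint, headPoint_add_smul, tailPoint_add_smul]
  split_ifs <;> simp

/-- The parameters enter affinely and the given curve enters only the constant term, so the linear
part is the same construction for the zero curve. -/
theorem controlPoint_add_smul (L M : D.ParamIdx → ℝ) (a : ℝ) (i : Fin (s + 1)) (j : ℕ) :
    D.controlPoint (L + a • M) i j
      = D.controlPoint L i j + a • D.homogeneous.controlPoint M i j := by
  simp only [controlPoint]
  split_ifs
  · rw [← innerPoint_add_smul]
    congr 1
    ext1 h
    exact boundaryPoint_add_smul D L M a i h
  · exact boundaryPoint_add_smul D L M a i j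

/-- The linear part of the affine map that sends the parameters to the control points. -/
def linearPart : (D.ParamIdx → ℝ) →ₗ[ℝ] Fin (s + 1) → ℕ → EuclideanSpace ℝ (Fin d) where
  toFun M := D.homogeneous.controlPoint M
  map_add' L M := by
    ext1 i; ext1 j
    have := D.homogeneous.controlPoint_add_smul L M 1 i j
    rwa [one_smul, one_smul] at this
  map_smul' a M := by
    ext1 i; ext1 j
    -- With all parameters zero this reads `x = x + x`, so the homogeneous construction vanishes at
    -- 0.
    have h0 := D.homogeneous.controlPoint_add_smul 0 0 1 i j
    have h := D.homogeneous.controlPoint_add_smul 0 M a i j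
    rw [one_smul, one_smul, zero_add] at h0
    have h0' : D.homogeneous.controlPoint 0 i j = 0 := left_eq_add.1 h0
    rw [zero_add, h0', zero_add] at h
    exact h

theorem controlPoint_add (L M : D.ParamIdx → ℝ) :
    D.controlPoint (L + M) = D.controlPoint L + D.linearPart M := by
  ext1 i; ext1 j
  have := D.controlPoint_add_smul L M 1 i j
  rwa [one_smul, one_smul] at this

theorem linearPart_eq_zero_of_boundary (M : D.ParamIdx → ℝ) (i : Fin (s + 1))
    (h1 : ∀ j, D.homogeneous.headPoint M i j = 0) (h2 : ∀ j, D.homogeneous.tailPoint M i j = 0)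
    (j : ℕ) : D.linearPart M i j = 0 := by
  have hb : ∀ j, D.homogeneous.boundaryPoint M i j = 0 := by
    intro j
    simp only [boundaryPoint, h1, h2, ite_self]
  change D.homogeneous.controlPoint M i j = 0
  rw [controlPoint, hb, ite_eq_right_iff]
  intro _
  simp [innerPoint, vPoint_zero, hb]

/-- A parameter at a partition point moves only the boundary points of the two segments meeting
there, and inner points depend linearly on the boundary points of their own segment. -/
theorem linearPart_single_eq_zero (ξ : D.ParamIdx) (i : Fin (s + 1)) (h1 : i ≠ ξ.1.1.castSucc)
    (h2 : i ≠ ξ.1.1.succ) (j : ℕ) : D.linearPart (Pi.single ξ 1) i j = 0 := by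
  have hlam : ∀ i' : Fin s, i' ≠ ξ.1.1 → ∀ j, D.homogeneous.lam (Pi.single ξ 1) i' j = 0 := by
    intro i' hi' j
    rw [lam]
    split_ifs
    · ext c
      rw [PiLp.toLp_apply, Pi.single_eq_of_ne, PiLp.zero_apply]
      intro h
      exact hi' (by rw [← h])
    · rfl
  apply linearPart_eq_zero_of_boundary
  · intro h
    revert h1 h2
    refine Fin.cases ?_ (fun i' => ?_) i
    · intro _ _
      rw [headPoint_zero, startPoint_zero]
    · intro _ h2
      have : i' ≠ ξ.1.1 := fun e => h2 (by rw [e])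
      rw [headPoint_succ, junctionRight, ← lam_zero]
      simp [hlam i' this]
  · intro h
    revert h1 h2
    refine Fin.lastCases ?_ (fun i' => ?_) i
    · intro _ _
      rw [tailPoint_last, endPoint_zero]
    · intro h1 _
      have : i' ≠ ξ.1.1 := fun e => h1 (by rw [e])
      rw [tailPoint_castSucc, junctionLeft, ← lam_zero]
      simp [hlam i' this]

/-- The parameters are recovered as scaled forward differences of the first control points of the
segment to the right of each partition point. -/
theorem eq_zero_of_linearPart_eq_zero (ht : StrictMono D.t)
    (hr : ∀ i : Fin (s + 1), D.r i.castSucc + D.r i.succ + 1 < D.m i) (M : D.ParamIdx → ℝ)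
    (h : ∀ i, ∀ j ≤ D.m i, D.linearPart M i j = 0) : M = 0 := by
  have hlam : ∀ i : Fin s, ∀ j ≤ D.r i.succ.castSucc, D.homogeneous.lam M i j = 0 := by
    intro i j hj
    have hle := order_le hr i
    have h1 := fwdDiff_junctionRight D.homogeneous M i j
    have h2 : ∀ j ≤ D.r i.succ.castSucc, D.homogeneous.junctionRight M i j = 0 := by
      intro j hj
      rw [← headPoint_succ, ← controlPoint_of_le (D := D.homogeneous) M i.succ j hj]
      exact h i.succ j (by omega)
    rw [(fwdDiff_iter_zero_congr_iff _ (fun _ => 0) _).2 h2 j hj, fwdDiff_iter_zero_fun] at h1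
    exact (smul_eq_zero.1 h1.symm).resolve_left
      (aCoeff_ne_zero D.homogeneous ht _ _ (hj.trans hle.2))
  ext ⟨⟨i, j⟩, c⟩
  have h1 := hlam i j (Nat.le_of_lt_succ j.2)
  rw [lam, dif_pos j.2] at h1
  exact congrFun (congrArg WithLp.ofLp h1) c

/-! ### The error as a quadratic function -/

/-- The bilinear form that belongs to the squared error on the `i`-th segment. -/
def localForm (i : Fin (s + 1)) (v w : ℕ → EuclideanSpace ℝ (Fin d)) : ℝ :=
  D.len i * ∑ c : Fin d, iForm (D.m i) (D.m i) (fun j => v j c) (fun j => w j c)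

/-- Half of the derivative of the squared error on the `i`-th segment at `w` in direction `v`. -/
def localGrad (i : Fin (s + 1)) (w v : ℕ → EuclideanSpace ℝ (Fin d)) : ℝ :=
  D.len i * ∑ c : Fin d, (iForm (D.m i) (D.m i) (fun j => w j c) (fun j => v j c)
    - iForm (D.n i) (D.m i) (fun j => D.p i j c) (fun j => v j c))

theorem localError_add (i : Fin (s + 1)) (w v : ℕ → EuclideanSpace ℝ (Fin d)) :
    D.localError i (w + v)
      = D.localError i w + 2 * D.localGrad i w v + D.localForm i v v := by
  simp only [localError, localGrad, localForm]
  rw [mul_left_comm 2, ← mul_add, ← mul_add, Finset.mul_sum (a := (2 : ℝ)),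
    ← Finset.sum_add_distrib,
    ← Finset.sum_add_distrib]
  congr 1
  refine Finset.sum_congr rfl fun c _ => ?_
  simp only [Pi.add_apply, PiLp.add_apply, iForm_add_right, iForm_add_left]
  rw [iForm_comm (D.m i) (fun j => v j c) (fun j => w j c)]
  ring

theorem localForm_add_left (i : Fin (s + 1)) (u v w : ℕ → EuclideanSpace ℝ (Fin d)) :
    D.localForm i (u + v) w = D.localForm i u w + D.localForm i v w := by
  simp only [localForm, Pi.add_apply, PiLp.add_apply, iForm_add_left, Finset.sum_add_distrib,
    mul_add]

theorem localForm_smul_left (i : Fin (s + 1)) (a : ℝ) (v w : ℕ → EuclideanSpace ℝ (Fin d)) :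
    D.localForm i (a • v) w = a * D.localForm i v w := by
  simp only [localForm, Pi.smul_apply, PiLp.smul_apply, smul_eq_mul, iForm_smul_left,
    ← Finset.mul_sum]
  ring

theorem localForm_comm (i : Fin (s + 1)) (v w : ℕ → EuclideanSpace ℝ (Fin d)) :
    D.localForm i v w = D.localForm i w v := by
  simp only [localForm, iForm_comm (D.m i) (fun j => v j _)]

theorem localForm_self_nonneg (ht : StrictMono D.t) (i : Fin (s + 1))
    (v : ℕ → EuclideanSpace ℝ (Fin d)) : 0 ≤ D.localForm i v v :=
  mul_nonneg (D.len_pos ht i).le (Finset.sum_nonneg fun _ _ => iForm_self_nonneg _ _)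

theorem eq_zero_of_localForm_self (ht : StrictMono D.t) (i : Fin (s + 1))
    (v : ℕ → EuclideanSpace ℝ (Fin d)) (h : D.localForm i v v = 0) :
    ∀ j ≤ D.m i, v j = 0 := by
  have h1 := (mul_eq_zero.1 h).resolve_left (D.len_pos ht i).ne'
  rw [Finset.sum_eq_zero_iff_of_nonneg fun _ _ => iForm_self_nonneg _ _] at h1
  intro j hj
  ext c
  exact eq_zero_of_iForm_self_eq_zero _ _ (h1 c (Finset.mem_univ c)) j hj

theorem localGrad_add_left (i : Fin (s + 1)) (w u v : ℕ → EuclideanSpace ℝ (Fin d)) :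
    D.localGrad i (w + u) v = D.localGrad i w v + D.localForm i u v := by
  simp only [localGrad, localForm]
  rw [← mul_add, ← Finset.sum_add_distrib]
  congr 1
  refine Finset.sum_congr rfl fun c _ => ?_
  simp only [Pi.add_apply, PiLp.add_apply, iForm_add_left]
  ring

theorem localGrad_add_right (i : Fin (s + 1)) (w u v : ℕ → EuclideanSpace ℝ (Fin d)) :
    D.localGrad i w (u + v) = D.localGrad i w u + D.localGrad i w v := by
  simp only [localGrad]
  rw [← mul_add, ← Finset.sum_add_distrib]
  congr 1
  refine Finset.sum_congr rfl fun c _ => ?_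
  simp only [Pi.add_apply, PiLp.add_apply, iForm_add_right]
  ring

theorem localGrad_smul_right (i : Fin (s + 1)) (a : ℝ) (w v : ℕ → EuclideanSpace ℝ (Fin d)) :
    D.localGrad i w (a • v) = a * D.localGrad i w v := by
  simp only [localGrad, Pi.smul_apply, PiLp.smul_apply, smul_eq_mul, iForm_smul_right,
    ← mul_sub, ← Finset.mul_sum]
  ring

theorem localGrad_congr_zero (i : Fin (s + 1)) (w v : ℕ → EuclideanSpace ℝ (Fin d))
    (h : ∀ j, v j = 0) : D.localGrad i w v = 0 := by
  have : v = (0 : ℝ) • v := by ext1 j; simp [h j]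
  rw [this, localGrad_smul_right, zero_mul]

/-- The bilinear form on the space of parameters that belongs to the total error. -/
def form : (D.ParamIdx → ℝ) →ₗ[ℝ] (D.ParamIdx → ℝ) →ₗ[ℝ] ℝ :=
  LinearMap.mk₂ ℝ (fun L M => ∑ i, D.localForm i (D.linearPart L i) (D.linearPart M i))
    (fun L L' M => by
      simp only [map_add, Pi.add_apply, localForm_add_left, Finset.sum_add_distrib])
    (fun a L M => by
      simp only [map_smul, Pi.smul_apply, localForm_smul_left, ← Finset.mul_sum, smul_eq_mul])
    (fun L M M' => by
      simp only [map_add, Pi.add_apply, localForm_comm D _ (D.linearPart L _), localForm_add_left,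
        Finset.sum_add_distrib])
    (fun a L M => by
      simp only [map_smul, Pi.smul_apply, localForm_comm D _ (D.linearPart L _),
        localForm_smul_left, ← Finset.mul_sum, smul_eq_mul])

theorem form_apply (L M : D.ParamIdx → ℝ) :
    D.form L M = ∑ i, D.localForm i (D.linearPart L i) (D.linearPart M i) := rfl

/-- Half of the derivative of the total error at the parameters `L`. -/
def grad (L : D.ParamIdx → ℝ) : (D.ParamIdx → ℝ) →ₗ[ℝ] ℝ where
  toFun M := ∑ i, D.localGrad i (D.controlPoint L i) (D.linearPart M i)
  map_add' M M' := by
    simp only [map_add, Pi.add_apply, localGrad_add_right, Finset.sum_add_distrib]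
  map_smul' a M := by
    simp only [map_smul, Pi.smul_apply, localGrad_smul_right, ← Finset.mul_sum, smul_eq_mul,
      RingHom.id_apply]

theorem grad_apply (L M : D.ParamIdx → ℝ) :
    D.grad L M = ∑ i, D.localGrad i (D.controlPoint L i) (D.linearPart M i) := rfl

theorem grad_add (L M : D.ParamIdx → ℝ) : D.grad (L + M) = D.grad L + D.form M := by
  refine LinearMap.ext fun M' => ?_
  simp only [LinearMap.add_apply, grad_apply, form_apply, controlPoint_add, Pi.add_apply,
    localGrad_add_left, Finset.sum_add_distrib]

theorem totalError_add (L M : D.ParamIdx → ℝ) :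
    D.totalError (L + M) = D.totalError L + 2 * D.grad L M + D.form M M := by
  have e : ∀ L, D.totalError L = ∑ i, D.localError i (D.controlPoint L i) := fun _ => rfl
  simp only [e, controlPoint_add, Pi.add_apply, localError_add, Finset.sum_add_distrib,
    grad_apply, form_apply, Finset.mul_sum]

theorem form_self_nonneg (ht : StrictMono D.t) (M : D.ParamIdx → ℝ) : 0 ≤ D.form M M := by
  rw [form_apply]
  exact Finset.sum_nonneg fun i _ => D.localForm_self_nonneg ht i _

/-- Definiteness combines two injectivity facts: a curve with zero norm has zero control points, and
these force zero parameters. -/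
theorem eq_zero_of_form_self (ht : StrictMono D.t)
    (hr : ∀ i : Fin (s + 1), D.r i.castSucc + D.r i.succ + 1 < D.m i) (M : D.ParamIdx → ℝ)
    (h : D.form M M = 0) : M = 0 := by
  rw [form_apply, Finset.sum_eq_zero_iff_of_nonneg fun i _ => D.localForm_self_nonneg ht i _] at h
  exact D.eq_zero_of_linearPart_eq_zero ht hr M fun i =>
    D.eq_zero_of_localForm_self ht i _ (h i (Finset.mem_univ i))

theorem linearMap_eq_sum_single (f : (D.ParamIdx → ℝ) →ₗ[ℝ] ℝ) (M : D.ParamIdx → ℝ) :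
    f M = ∑ ξ, M ξ * f (Pi.single ξ 1) := by
  rw [f.pi_apply_eq_sum_univ M]
  refine Finset.sum_congr rfl fun ξ _ => ?_
  rw [smul_eq_mul]
  congr 2
  ext η
  simp [Pi.single_apply, eq_comm]

/-! ### The system of linear equations -/

theorem hasPartialDeriv_segError (L : D.ParamIdx → ℝ) (ξ : D.ParamIdx) (i : Fin (s + 1)) :
    D.HasPartialDeriv (fun L' => D.segError L' i)
      (2 * D.localGrad i (D.controlPoint L i) (D.linearPart (Pi.single ξ 1) i)) L ξ := by
  -- Changing one coordinate is motion along a unit vector, so the error is a quadratic polynomial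
  -- in `x - L ξ` and its linear coefficient is the derivative.
  have e : (fun x : ℝ => D.segError (Function.update L ξ x) i) = fun x =>
      D.localError i (D.controlPoint L i)
        + 2 * ((x - L ξ) * D.localGrad i (D.controlPoint L i) (D.linearPart (Pi.single ξ 1) i))
        + (x - L ξ) * ((x - L ξ) *
          D.localForm i (D.linearPart (Pi.single ξ 1) i) (D.linearPart (Pi.single ξ 1) i)) := by
    ext1 x
    have hu : Function.update L ξ x = L + (x - L ξ) • Pi.single ξ (1 : ℝ) := by
      ext η
      by_cases h : η = ξ
      · subst h; simp
      · simp [h]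
    change D.localError i (D.controlPoint (Function.update L ξ x) i) = _
    rw [hu, controlPoint_add, Pi.add_apply, localError_add, map_smul, Pi.smul_apply,
      localGrad_smul_right, localForm_smul_left, localForm_comm, localForm_smul_left]
  rw [HasPartialDeriv, e]
  have hx : HasDerivAt (fun x : ℝ => x - L ξ) 1 (L ξ) := (hasDerivAt_id _).sub_const _
  have h := (((hx.mul_const (D.localGrad i (D.controlPoint L i)
    (D.linearPart (Pi.single ξ 1) i))).const_mul 2).const_add
      (D.localError i (D.controlPoint L i))).add (hx.mul (hx.mul_const
        (D.localForm i (D.linearPart (Pi.single ξ 1) i) (D.linearPart (Pi.single ξ 1) i))))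
  convert! h using 1
  simp

theorem hasPartialDeriv_totalError (L : D.ParamIdx → ℝ) (ξ : D.ParamIdx) :
    D.HasPartialDeriv D.totalError (2 * D.grad L (Pi.single ξ 1)) L ξ := by
  rw [grad_apply, Finset.mul_sum]
  exact HasDerivAt.fun_sum fun i _ => D.hasPartialDeriv_segError L ξ i

theorem hasPartialDeriv_adjacent (L : D.ParamIdx → ℝ) (ξ : D.ParamIdx) :
    D.HasPartialDeriv (fun L' => D.segError L' ξ.1.1.castSucc + D.segError L' ξ.1.1.succ)
      (2 * D.grad L (Pi.single ξ 1)) L ξ := by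
  have hne : ξ.1.1.castSucc ≠ ξ.1.1.succ := (Fin.castSucc_lt_succ).ne
  have hg : D.grad L (Pi.single ξ 1)
      = ∑ i ∈ {ξ.1.1.castSucc, ξ.1.1.succ},
        D.localGrad i (D.controlPoint L i) (D.linearPart (Pi.single ξ 1) i) := by
    rw [grad_apply]
    symm
    apply Finset.sum_subset (Finset.subset_univ _)
    intro i _ hi
    simp only [Finset.mem_insert, Finset.mem_singleton, not_or] at hi
    exact D.localGrad_congr_zero i _ _ (D.linearPart_single_eq_zero ξ i hi.1 hi.2)
  rw [hg, Finset.sum_pair hne, mul_add]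
  exact (D.hasPartialDeriv_segError L ξ _).add (D.hasPartialDeriv_segError L ξ _)

/-- By `grad_add` the gradient is affine in `L`; the matrix is that of the quadratic part on unit
vectors, doubled. -/
theorem exists_linear_system : ∃ (A : Matrix D.ParamIdx D.ParamIdx ℝ) (b : D.ParamIdx → ℝ),
    ∀ (L : D.ParamIdx → ℝ) (ξ : D.ParamIdx), (A *ᵥ L) ξ - b ξ = 2 * D.grad L (Pi.single ξ 1) := by
  refine ⟨fun ξ η => 2 * D.form (Pi.single η 1) (Pi.single ξ 1),
    fun ξ => -(2 * D.grad 0 (Pi.single ξ 1)), fun L ξ => ?_⟩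
  have h := D.linearMap_eq_sum_single (D.form.flip (Pi.single ξ 1)) L
  simp only [LinearMap.flip_apply] at h
  have h2 := D.grad_add 0 L
  rw [zero_add] at h2
  change ∑ η, 2 * D.form (Pi.single η 1) (Pi.single ξ 1) * L η - _ = _
  rw [h2, LinearMap.add_apply, h, mul_add, Finset.mul_sum, sub_neg_eq_add, add_comm]
  congr 1
  exact Finset.sum_congr rfl fun η _ => by ring

theorem solvesSystem_iff (L : D.ParamIdx → ℝ) : D.SolvesSystem L ↔ D.grad L = 0 := by
  constructor
  · intro h
    refine LinearMap.ext fun M => ?_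
    rw [D.linearMap_eq_sum_single]
    refine Finset.sum_eq_zero fun ξ _ => ?_
    have := (h ξ).unique (D.hasPartialDeriv_totalError L ξ)
    rw [show D.grad L (Pi.single ξ 1) = 0 by linarith, mul_zero]
  · intro h ξ
    have := D.hasPartialDeriv_totalError L ξ
    rwa [h, LinearMap.zero_apply, mul_zero] at this

/-- The system says `form L = -grad 0`. A definite form is injective as a map into the dual space,
hence bijective by equality of dimensions. -/
theorem existsUnique_solvesSystem (ht : StrictMono D.t)
    (hr : ∀ i : Fin (s + 1), D.r i.castSucc + D.r i.succ + 1 < D.m i) :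
    ∃! L : D.ParamIdx → ℝ, D.SolvesSystem L := by
  have hinj : Function.Injective D.form := by
    rw [injective_iff_map_eq_zero]
    intro M hM
    exact D.eq_zero_of_form_self ht hr M (by rw [hM, LinearMap.zero_apply])
  have hsurj : Function.Surjective D.form :=
    (LinearMap.injective_iff_surjective_of_finrank_eq_finrank
      (Subspace.dual_finrank_eq (K := ℝ) (V := D.ParamIdx → ℝ)).symm).1 hinj
  have hgrad : ∀ L, D.grad L = D.grad 0 + D.form L := fun L => by
    rw [← D.grad_add, zero_add]
  obtain ⟨L, hL⟩ := hsurj (-D.grad 0)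
  refine ⟨L, (D.solvesSystem_iff L).2 (by rw [hgrad, hL, add_neg_cancel]), fun L' hL' => ?_⟩
  apply hinj
  rw [hL, eq_neg_iff_add_eq_zero, add_comm, ← hgrad]
  exact (D.solvesSystem_iff L').1 hL'

/-! ### The solution of the optimization problem -/

/-- Pythagoras for fixed parameters: the deviation from the computed points vanishes at boundary
indices, so the cross term is zero by orthogonality of the residual. -/
theorem sum_localError_eq (hr : ∀ i : Fin (s + 1), D.r i.castSucc + D.r i.succ + 1 < D.m i)
    (L : D.ParamIdx → ℝ) (q : Fin (s + 1) → ℕ → EuclideanSpace ℝ (Fin d))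
    (hq : D.HasBoundary L q) : ∑ i, D.localError i (q i) = D.totalError L
      + ∑ i, D.localForm i (q i - D.controlPoint L i) (q i - D.controlPoint L i) := by
  have e : D.totalError L = ∑ i, D.localError i (D.controlPoint L i) := rfl
  rw [e, ← Finset.sum_add_distrib]
  refine Finset.sum_congr rfl fun i _ => ?_
  have h := D.localError_add i (D.controlPoint L i) (q i - D.controlPoint L i)
  rw [add_sub_cancel] at h
  have hb := hasBoundary_controlPoint hr L
  have hgrad : D.localGrad i (D.controlPoint L i) (q i - D.controlPoint L i) = 0 := by
    rw [localGrad, Finset.sum_eq_zero, mul_zero]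
    intro c _
    rw [sub_eq_zero]
    apply iForm_eq_of_innerPoint _ _ (D.r i.castSucc) (D.r i.succ) (hr i) _ _
      (fun j hj => controlPoint_inner hr L i j hj)
    · intro j hj
      rw [Pi.sub_apply, hq.1 i j hj, hb.1 i j hj, sub_self, PiLp.zero_apply]
    · intro j hj hj'
      obtain ⟨h, rfl⟩ : ∃ h, j = D.m i - h := ⟨D.m i - j, by omega⟩
      have hle := hr i
      rw [show D.m i - h = D.m i - (D.m i - (D.m i - h)) by omega, Pi.sub_apply,
        hq.2 i _ (by omega), hb.2 i _ (by omega), sub_self, PiLp.zero_apply]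
  rw [h, hgrad]
  ring

variable {D}

theorem exists_isAdmissible_controlPoint (ht : StrictMono D.t)
    (hr : ∀ i : Fin (s + 1), D.r i.castSucc + D.r i.succ + 1 < D.m i)
    {P : ℝ → EuclideanSpace ℝ (Fin d)} (hP : IsPiecewise D.t D.n D.p P) (L : D.ParamIdx → ℝ) :
    ∃ Q, D.IsAdmissible P (D.controlPoint L) Q ∧ D.sqError P Q = D.totalError L := by
  have hc : D.Compatible (D.controlPoint L) :=
    (compatible_iff_exists_hasBoundary ht hr _).2 ⟨L, hasBoundary_controlPoint hr L⟩
  obtain ⟨Q, hQ⟩ := exists_isComposite ht hc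
  exact ⟨Q, (isAdmissible_iff ht hr hP _ Q).2 ⟨hQ, hc⟩, sqError_eq ht hP hQ⟩

/-- Splits the excess error into a cost for having parameters `L'` instead of the critical `L`, and
a cost for not using the best inner points for `L'`. -/
theorem sqError_of_isAdmissible (ht : StrictMono D.t)
    (hr : ∀ i : Fin (s + 1), D.r i.castSucc + D.r i.succ + 1 < D.m i)
    {P : ℝ → EuclideanSpace ℝ (Fin d)} (hP : IsPiecewise D.t D.n D.p P) {L : D.ParamIdx → ℝ}
    (hL : D.SolvesSystem L) {q : Fin (s + 1) → ℕ → EuclideanSpace ℝ (Fin d)}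
    {Q : ℝ → EuclideanSpace ℝ (Fin d)} (hQ : D.IsAdmissible P q Q) :
    ∃ L', D.sqError P Q = D.totalError L + D.form (L' - L) (L' - L)
      + ∑ i, D.localForm i (q i - D.controlPoint L' i) (q i - D.controlPoint L' i) := by
  obtain ⟨hc, hq⟩ := (isAdmissible_iff ht hr hP q Q).1 hQ
  obtain ⟨L', hL'⟩ := (compatible_iff_exists_hasBoundary ht hr q).1 hq
  refine ⟨L', ?_⟩
  have h := D.totalError_add L (L' - L)
  rw [add_sub_cancel, (D.solvesSystem_iff L).1 hL, LinearMap.zero_apply, mul_zero, add_zero] at h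
  rw [sqError_eq ht hP hc, D.sum_localError_eq hr L' q hL', h]

theorem isAdmissible_congr {P Q : ℝ → EuclideanSpace ℝ (Fin d)}
    {q q' : Fin (s + 1) → ℕ → EuclideanSpace ℝ (Fin d)} (h : ∀ i, ∀ j ≤ D.m i, q i j = q' i j)
    (hQ : D.IsAdmissible P q Q) : D.IsAdmissible P q' Q := by
  refine ⟨fun i x hx => ?_, hQ.2⟩
  rw [← curve_congr (D.m i) (q i) (q' i) (h i)]
  exact hQ.1 i x hx

theorem isSolution_iff (ht : StrictMono D.t)
    (hr : ∀ i : Fin (s + 1), D.r i.castSucc + D.r i.succ + 1 < D.m i)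
    {P : ℝ → EuclideanSpace ℝ (Fin d)} (hP : IsPiecewise D.t D.n D.p P) {L : D.ParamIdx → ℝ}
    (hL : D.SolvesSystem L) (q : Fin (s + 1) → ℕ → EuclideanSpace ℝ (Fin d)) :
    D.IsSolution P q ↔ ∀ i, ∀ j ≤ D.m i, q i j = D.controlPoint L i j := by
  obtain ⟨Q₀, hQ₀, herr⟩ := exists_isAdmissible_controlPoint ht hr hP L
  have hnonneg : ∀ w : Fin (s + 1) → ℕ → EuclideanSpace ℝ (Fin d),
      0 ≤ ∑ i, D.localForm i (w i) (w i) :=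
    fun w => Finset.sum_nonneg fun i _ => D.localForm_self_nonneg ht i (w i)
  constructor
  · rintro ⟨Q, hQ, hmin⟩
    obtain ⟨L', hL'⟩ := sqError_of_isAdmissible ht hr hP hL hQ
    have hle := hmin _ _ hQ₀
    rw [herr, hL'] at hle
    have h1 := D.form_self_nonneg ht (L' - L)
    have h2 := hnonneg fun i => q i - D.controlPoint L' i
    -- Minimality bounds the sum of the two nonnegative excess terms by zero, so each of them
    -- vanishes.
    have h3 : L' = L := sub_eq_zero.1 (D.eq_zero_of_form_self ht hr _ (by linarith))
    have h4 : ∑ i, D.localForm i (q i - D.controlPoint L' i) (q i - D.controlPoint L' i) = 0 := by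
      linarith
    rw [Finset.sum_eq_zero_iff_of_nonneg fun i _ => D.localForm_self_nonneg ht i _] at h4
    intro i j hj
    have := D.eq_zero_of_localForm_self ht i _ (h4 i (Finset.mem_univ i)) j hj
    rw [Pi.sub_apply, sub_eq_zero, h3] at this
    exact this
  · intro h
    refine ⟨Q₀, isAdmissible_congr (fun i j hj => (h i j hj).symm) hQ₀, fun q' Q' hQ' => ?_⟩
    obtain ⟨L', hL'⟩ := sqError_of_isAdmissible ht hr hP hL hQ'
    have h1 := D.form_self_nonneg ht (L' - L)
    have h2 := hnonneg fun i => q' i - D.controlPoint L' i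
    rw [herr, hL']
    linarith

end Data

end Bezier
end

/-! ### The main theorem -/

theorem mainTheorem1 (d s : ℕ) (D : Bezier.Data d s)
    (ht : StrictMono D.t)
    (hmn : ∀ i, D.m i < D.n i)
    (hr : ∀ i : Fin (s + 1), D.r i.castSucc + D.r i.succ + 1 < D.m i)
    (P : ℝ → EuclideanSpace ℝ (Fin d)) (hP : Bezier.IsPiecewise D.t D.n D.p P) :
    -- the computed `C`-table of every segment gives the dual constrained Bernstein basis
    (∀ i : Fin (s + 1),
      ∀ j ∈ Finset.Icc (D.r i.castSucc + 1) (D.m i - D.r i.succ - 1),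
      ∀ h ∈ Finset.Icc (D.r i.castSucc + 1) (D.m i - D.r i.succ - 1),
        ∫ u in (0 : ℝ)..1,
          Bezier.dualBern (D.m i) (D.r i.castSucc) (D.r i.succ) j u * Bezier.bern (D.m i) h u
            = if j = h then 1 else 0) ∧
    -- for every choice of the parameters, the control points define an admissible curve,
    -- whose squared error is the explicit function `E` of the parameters
    (∀ L : D.ParamIdx → ℝ, ∃ Q, D.IsAdmissible P (D.controlPoint L) Q ∧
      D.sqError P Q = D.totalError L) ∧
    -- the equations for the parameters form a square system of linear equations, and in the
    -- equations that belong to a partition point only the two adjacent segments matter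
    (∃ (A : Matrix D.ParamIdx D.ParamIdx ℝ) (b : D.ParamIdx → ℝ),
      ∀ (L : D.ParamIdx → ℝ) (ξ : D.ParamIdx),
        D.HasPartialDeriv D.totalError ((A *ᵥ L) ξ - b ξ) L ξ ∧
        D.HasPartialDeriv
          (fun L' => D.segError L' ξ.1.1.castSucc + D.segError L' ξ.1.1.succ)
          ((A *ᵥ L) ξ - b ξ) L ξ) ∧
    -- the system has exactly one solution
    (∃! L : D.ParamIdx → ℝ, D.SolvesSystem L) ∧
    -- the control points returned for it are the solution of the problem
    (∀ L : D.ParamIdx → ℝ, D.SolvesSystem L →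
      ∀ q : Fin (s + 1) → ℕ → EuclideanSpace ℝ (Fin d),
        D.IsSolution P q ↔ ∀ i, ∀ j ≤ D.m i, q i j = D.controlPoint L i j) := by
  refine ⟨fun i j hj h hh => Bezier.integral_dualBern_mul_bern _ _ _ (hr i) j h hj hh,
    Bezier.Data.exists_isAdmissible_controlPoint ht hr hP, ?_,
    D.existsUnique_solvesSystem ht hr, fun L hL q => Bezier.Data.isSolution_iff ht hr hP hL q⟩
  obtain ⟨A, b, h⟩ := D.exists_linear_system
  refine ⟨A, b, fun L ξ => ?_⟩
  rw [h L ξ]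
  exact ⟨D.hasPartialDeriv_totalError L ξ, D.hasPartialDeriv_adjacent L ξ⟩
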